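/- A fair cost-sharing game with $N$ agents and a finite action set $\mathcal{A}$, with costs bounded by $H\ge 0$, consists of a map $f:\mathcal{A}\to 2^{[N]}$ (agent $i$ may use action $a$ iff $i\in f(a)$, and every agent may use at least one action) and a prior probability distribution $\theta$ over cost vectors $c\in[0,H]^{\mathcal{A}}$. For a joint action $s=(s_1,\dots,s_N)$ with $i\in f(s_i)$ for all $i$, let $k_a(s)$ be the number of agents with $s_i=a$; the prior cost of agent $i$ is $\mathrm{cost}_i(s)=\mathbb{E}_{\theta}[c(s_i)]/k_{s_i}(s)$. A vector of subsidies $\sigma\in[0,H]^{\mathcal{A}}$ gives agent $i$ the subsidy $\mathrm{subs}_i(s)=\sigma(s_i)/k_{s_i}(s)$, so that the subsidized cost is $\mathrm{cost}^{\sigma}_i=\mathrm{cost}_i-\mathrm{subs}_i$. Let $\mathcal{S}_{NE}(\sigma)$ be the set of pure Nash equilibria of the game with costs $\mathrm{cost}_i^{\sigma}$, and let $$L_{\mathrm{prior}}(\sigma)=\max_{s\in\mathcal{S}_{NE}(\sigma)}\ \sum_{i}\mathrm{cost}_i^{\sigma}(s)+\sum_i\mathrm{subs}_i(s).$$ Theorem.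 There is a universal constant $C>0$ such that for all $N$, $\mathcal{A}$, $H\ge 0$, all $\epsilon,\delta>0$, every probability distribution $\mathcal{D}$ over fair cost-sharing games with $N$ agents, action set $\mathcal{A}$ and costs bounded by $H$, and every number of samples $$m\ \ge\ C\,\frac{|\mathcal{A}|^2H^2}{\epsilon^2}\left(|\mathcal{A}|\log(|\mathcal{A}|N)+\log\frac1\delta\right),$$ (with the convention $\log 0=0$) the following holds. For every sample of $m$ games there is a vector $\hat\sigma\in[0,H]^{\mathcal{A}}$ that minimizes the average of $L_{\mathrm{prior}}$ over the sample, and with probability at least $1-\delta$ over the draw of $m$ games i.i.d. from $\mathcal{D}$, every such minimizer $\hat\sigma$ satisfies $$\mathbb{E}_{G\sim\mathcal{D}}[L_{\mathrm{prior}}(\hat\sigma)]\ \le\ \inf_{\sigma\in[0,H]^{\mathcal{A}}}\mathbb{E}_{G\sim\mathcal{D}}[L_{\mathrm{prior}}(\sigma)]+\epsilon .$$ -/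

import Mathlib

open MeasureTheory

/-- A (Bayesian) fair cost-sharing game with agents `Fin N` and finite action set `A`, whose action
costs lie in `[0, H]`. Agent `i` may use action `a` iff `i ∈ avail a`, every agent may use some
action, and `prior` is the common prior distribution of the vector of action costs. The classical
game with a deterministic cost vector `c` is the case where `prior` is the Dirac mass at `c`. -/
structure CostSharingGame (N : ℕ) (A : Type*) (H : ℝ) where
  avail : A → Finset (Fin N)
  exists_avail : ∀ i : Fin N, ∃ a : A, i ∈ avail a
  prior : Measure (A → ℝ)
  isProbabilityMeasure_prior : IsProbabilityMeasure prior
  cost_mem : ∀ᵐ c ∂prior, ∀ a : A, c a ∈ Set.Icc 0 H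

namespace CostSharingGame

variable {N : ℕ} {A : Type*} {H : ℝ}

/-- The σ-algebra on games: the coarsest one for which the availability map (with values in a
finite discrete space) and the prior (with values in the space of measures with its usual
σ-algebra) are measurable. -/
instance instMeasurableSpace : MeasurableSpace (CostSharingGame N A H) :=
  MeasurableSpace.comap avail ⊤ ⊔ MeasurableSpace.comap prior inferInstance

/-- The mean cost of action `a` under the prior. -/
noncomputable def meanCost (G : CostSharingGame N A H) (a : A) : ℝ :=
  ∫ c, c a ∂G.prior

/-- The joint action `s` is feasible: each agent uses an action that is available to it. -/
def IsFeasible (G : CostSharingGame N A H) (s : Fin N → A) : Prop :=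
  ∀ i, i ∈ G.avail (s i)

section

variable [DecidableEq A]

/-- The number of agents that use action `a` in the joint action `s`. -/
def users (s : Fin N → A) (a : A) : ℕ :=
  (Finset.univ.filter fun j => s j = a).card

/-- The expected cost of agent `i` in the prior game, without subsidy. -/
noncomputable def agentCost (G : CostSharingGame N A H) (s : Fin N → A) (i : Fin N) : ℝ :=
  G.meanCost (s i) / users s (s i)

/-- The subsidy received by agent `i` when the vector of subsidies on actions is `σ`. -/
noncomputable def agentSubsidy (σ : A → ℝ) (s : Fin N → A) (i : Fin N) : ℝ :=
  σ (s i) / users s (s i)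

/-- The cost of agent `i` in the prior game subsidized by `σ`. -/
noncomputable def subsidizedCost (G : CostSharingGame N A H) (σ : A → ℝ) (s : Fin N → A)
    (i : Fin N) : ℝ :=
  G.agentCost s i - agentSubsidy σ s i

/-- The joint action `s` is a pure Nash equilibrium of the prior game subsidized by `σ`. -/
def IsNash (G : CostSharingGame N A H) (σ : A → ℝ) (s : Fin N → A) : Prop :=
  G.IsFeasible s ∧ ∀ (i : Fin N) (a : A), i ∈ G.avail a →
    G.subsidizedCost σ s i ≤ G.subsidizedCost σ (Function.update s i a) i

/-- Total subsidized cost of all agents, plus the total subsidy paid by the central agent. -/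
noncomputable def totalCost (G : CostSharingGame N A H) (σ : A → ℝ) (s : Fin N → A) : ℝ :=
  (∑ i, G.subsidizedCost σ s i) + ∑ i, agentSubsidy σ s i

/-- The loss of the subsidy vector `σ` in the prior game: the largest total cost (including the
subsidies) over all Nash equilibria of the subsidized game. For finite `A` the supremum is a
maximum, see `isGreatest_loss`. -/
noncomputable def loss (G : CostSharingGame N A H) (σ : A → ℝ) : ℝ :=
  sSup {x | ∃ s, G.IsNash σ s ∧ x = G.totalCost σ s}

end

/-- The admissible subsidy vectors: each action gets a subsidy in `[0, H]`. -/
def subsidyVectors (A : Type*) (H : ℝ) : Set (A → ℝ) :=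
  {σ | ∀ a, σ a ∈ Set.Icc 0 H}

section

variable [DecidableEq A]

/-- The average loss of `σ` over a sample of `m` games. -/
noncomputable def empiricalLoss {m : ℕ} (S : Fin m → CostSharingGame N A H) (σ : A → ℝ) : ℝ :=
  (∑ k, (S k).loss σ) / m

/-- The expected loss of `σ` under the distribution `D` over games. -/
noncomputable def expectedLoss (D : Measure (CostSharingGame N A H)) (σ : A → ℝ) : ℝ :=
  ∫ G, G.loss σ ∂D

/-- `σ` is a best admissible vector of subsidies over the sample `S`. -/
def IsBestOnSample {m : ℕ} (S : Fin m → CostSharingGame N A H) (σ : A → ℝ) : Prop :=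
  σ ∈ subsidyVectors A H ∧ ∀ τ ∈ subsidyVectors A H, empiricalLoss S σ ≤ empiricalLoss S τ

/-! The remaining facts of this section show that the loss is a genuine maximum and that its
expectation is a genuine integral. -/

lemma exists_isNash [Fintype A] (G : CostSharingGame N A H) (σ : A → ℝ) :
    ∃ s, G.IsNash σ s := by
  classical
  set w : A → ℝ := fun a => G.meanCost a - σ a with hw
  set F : A → ℕ → ℝ := fun a n => ∑ k ∈ Finset.range n, w a / ((k : ℝ) + 1) with hF
  set P : (Fin N → A) → ℝ := fun s => ∑ a, F a (users s a) with hP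
  set r : Fin N → (Fin N → A) → A → ℕ := fun i s a =>
    ((Finset.univ.erase i).filter fun j => s j = a).card with hr
  have hu : ∀ i s a, users s a = r i s a + if s i = a then 1 else 0 := by
    intro i s a
    simp only [users, hr]
    rw [← Finset.insert_erase (Finset.mem_univ i), Finset.filter_insert]
    split_ifs with h
    · rw [Finset.card_insert_of_notMem (by simp)]
      simp
    · simp
  have hcost : ∀ i s, G.subsidizedCost σ s i = w (s i) / ((r i s (s i) : ℝ) + 1) := by
    intro i s
    have := hu i s (s i)
    simp only [if_true] at this
    simp only [subsidizedCost, agentCost, agentSubsidy, this, hw]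
    push_cast
    rw [sub_div]
  have hPi : ∀ i s, P s = (∑ a, F a (r i s a)) + G.subsidizedCost σ s i := by
    intro i s
    have h1 : ∀ a, F a (users s a) =
        F a (r i s a) + if s i = a then w a / ((r i s a : ℝ) + 1) else 0 := by
      intro a
      rw [hu i s a]
      split_ifs with h
      · simp only [hF, Finset.sum_range_succ]
      · simp
    simp only [hP, h1, Finset.sum_add_distrib, Finset.sum_ite_eq, Finset.mem_univ, if_true, hcost]
  have hrup : ∀ i s a, r i (Function.update s i a) = r i s := by
    intro i s a
    funext b
    simp only [hr]
    congr 1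
    refine Finset.filter_congr fun j hj => ?_
    rw [Function.update_of_ne (Finset.ne_of_mem_erase hj)]
  choose s0 hs0 using G.exists_avail
  obtain ⟨s, hs, hmin⟩ := Finset.exists_min_image
    (Finset.univ.filter fun s : Fin N → A => G.IsFeasible s) P ⟨s0, Finset.mem_filter.2 ⟨Finset.mem_univ _, hs0⟩⟩
  have hsf : G.IsFeasible s := by simpa using hs
  refine ⟨s, hsf, fun i a ha => ?_⟩
  have hfe : G.IsFeasible (Function.update s i a) := by
    intro j
    by_cases hj : j = i
    · subst hj; simpa using ha
    · simpa [Function.update_of_ne hj] using hsf j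
  have h := hmin (Function.update s i a) (by simpa using hfe)
  rw [hPi i s, hPi i (Function.update s i a), hrup] at h
  linarith

lemma isGreatest_loss [Fintype A] (G : CostSharingGame N A H) (σ : A → ℝ) :
    IsGreatest {x | ∃ s, G.IsNash σ s ∧ x = G.totalCost σ s} (G.loss σ) := by
  have hfin : Set.Finite {x | ∃ s, G.IsNash σ s ∧ x = G.totalCost σ s} :=
    (Set.finite_range fun s => G.totalCost σ s).subset (by rintro x ⟨s, -, rfl⟩; exact ⟨s, rfl⟩)
  obtain ⟨s, hs⟩ := G.exists_isNash σ
  have hne : Set.Nonempty {x | ∃ s, G.IsNash σ s ∧ x = G.totalCost σ s} := ⟨_, s, hs, rfl⟩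
  exact ⟨hne.csSup_mem hfin, fun x hx => le_csSup hfin.bddAbove hx⟩

end

lemma measurable_avail : Measurable[_, ⊤] (avail : CostSharingGame N A H → _) :=
  fun _ hs => le_sup_left (α := MeasurableSpace (CostSharingGame N A H)) _ ⟨_, hs, rfl⟩

lemma measurable_prior : Measurable (prior : CostSharingGame N A H → _) :=
  fun _ hs => le_sup_right (α := MeasurableSpace (CostSharingGame N A H)) _ ⟨_, hs, rfl⟩

lemma meanCost_mem (G : CostSharingGame N A H) (a : A) : G.meanCost a ∈ Set.Icc 0 H := by
  have := G.isProbabilityMeasure_prior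
  have h0 : ∀ᵐ c ∂G.prior, 0 ≤ c a := G.cost_mem.mono fun c hc => (hc a).1
  have h1 : ∀ᵐ c ∂G.prior, c a ≤ H := G.cost_mem.mono fun c hc => (hc a).2
  have hi : Integrable (fun c : A → ℝ => c a) G.prior := by
    refine Integrable.of_bound (measurable_pi_apply a).aestronglyMeasurable H ?_
    filter_upwards [h0, h1] with c hc0 hc1
    rwa [Real.norm_of_nonneg hc0]
  refine ⟨integral_nonneg_of_ae h0, ?_⟩
  have := integral_mono_ae hi (integrable_const H) h1
  simpa [meanCost] using this

lemma measurable_meanCost (a : A) :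
    Measurable fun G : CostSharingGame N A H => G.meanCost a := by
  have h : (fun G : CostSharingGame N A H => G.meanCost a) =
      fun G => (∫⁻ c, ENNReal.ofReal (c a) ∂G.prior).toReal := by
    funext G
    exact integral_eq_lintegral_of_nonneg_ae (G.cost_mem.mono fun c hc => (hc a).1)
      (measurable_pi_apply a).aestronglyMeasurable
  rw [h]
  exact ((Measure.measurable_lintegral
    (measurable_pi_apply a).ennreal_ofReal).comp measurable_prior).ennreal_toReal

section

variable [DecidableEq A]

lemma measurable_loss [Fintype A] (σ : A → ℝ) :
    Measurable fun G : CostSharingGame N A H => G.loss σ := by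
  have hsub : ∀ s i, Measurable fun G : CostSharingGame N A H => G.subsidizedCost σ s i :=
    fun s i => ((measurable_meanCost (s i)).div_const _).sub_const _
  have htot : ∀ s, Measurable fun G : CostSharingGame N A H => G.totalCost σ s :=
    fun s => (Finset.measurable_sum _ fun i _ => hsub s i).add_const _
  have hav : ∀ i a, MeasurableSet {G : CostSharingGame N A H | i ∈ G.avail a} :=
    fun i a => measurable_avail (t := {f | i ∈ f a}) trivial
  have hnash : ∀ s, MeasurableSet {G : CostSharingGame N A H | G.IsNash σ s} := by
    intro s
    have : {G : CostSharingGame N A H | G.IsNash σ s} =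
        (⋂ i, {G | i ∈ G.avail (s i)}) ∩ ⋂ i, ⋂ a, ({G | i ∈ G.avail a}ᶜ ∪
          {G | G.subsidizedCost σ s i ≤ G.subsidizedCost σ (Function.update s i a) i}) := by
      ext G
      simp [IsNash, IsFeasible, imp_iff_not_or]
    rw [this]
    exact (MeasurableSet.iInter fun i => hav _ _).inter <| MeasurableSet.iInter fun i =>
      MeasurableSet.iInter fun a => (hav _ _).compl.union (measurableSet_le (hsub _ _) (hsub _ _))
  refine measurable_of_Iic fun x => ?_
  have : (fun G : CostSharingGame N A H => G.loss σ) ⁻¹' Set.Iic x =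
      ⋂ s, ({G | G.IsNash σ s}ᶜ ∪ {G | G.totalCost σ s ≤ x}) := by
    ext G
    have hG := G.isGreatest_loss σ
    simp only [Set.mem_preimage, Set.mem_Iic, Set.mem_iInter, Set.mem_union, Set.mem_compl_iff,
      Set.mem_ofPred_eq, ← imp_iff_not_or]
    constructor
    · exact fun h s hs => (hG.2 ⟨s, hs, rfl⟩).trans h
    · intro h
      obtain ⟨s, hs, he⟩ := hG.1
      exact he ▸ h s hs
  rw [this]
  exact MeasurableSet.iInter fun s => (hnash s).compl.union (measurableSet_le (htot s)
    measurable_const)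

lemma integrable_loss [Fintype A] (D : Measure (CostSharingGame N A H)) [IsProbabilityMeasure D]
    (σ : A → ℝ) : Integrable (fun G => G.loss σ) D := by
  refine Integrable.of_bound (measurable_loss σ).aestronglyMeasurable (N * |H|)
    (Filter.Eventually.of_forall fun G => ?_)
  obtain ⟨s, -, he⟩ := (G.isGreatest_loss σ).1
  have hb : ∀ i, |G.agentCost s i| ≤ |H| := by
    intro i
    have h := G.meanCost_mem (s i)
    rw [agentCost, abs_div, abs_of_nonneg h.1, Nat.abs_cast]
    exact (div_le_self h.1 (by
      have : 0 < users s (s i) := Finset.card_pos.2 ⟨i, by simp⟩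
      exact_mod_cast this)).trans (h.2.trans (le_abs_self H))
  rw [he, totalCost, ← Finset.sum_add_distrib, Real.norm_eq_abs]
  calc |∑ i, (G.subsidizedCost σ s i + agentSubsidy σ s i)|
      = |∑ i, G.agentCost s i| := by simp [subsidizedCost]
    _ ≤ ∑ i, |G.agentCost s i| := Finset.abs_sum_le_sum_abs _ _
    _ ≤ ∑ _i : Fin N, |H| := Finset.sum_le_sum fun i _ => hb i
    _ = N * |H| := by simp

end

end CostSharingGame

/-! The theorem follows from uniform convergence: if every empirical average is within `ε / 2` of
its expectation, an empirical minimizer is `ε`-optimal. The work is to prove this without a `log m`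
factor, which a plain union bound over the values on the sample would cost.

Two facts about the game make the loss class simple. Subsidies are transfers, so the total cost of a
joint action does not depend on `σ`; and whether it is an equilibrium depends only on comparisons
`(μ a - σ a) / k ≤ (μ b - σ b) / l` with `k, l ≤ N`, where `μ` denotes the mean costs
(`loss_congr`). These are signs of affine functionals of `σ`. By Sauer–Shelah and a bound `#A + 1`
on the VC dimension (`card_le_of_injOn_nonneg_pattern`), the losses on `n` games take at most `(#A²
N² n + 1) ^ (#A + 1)` joint values. Moreover the loss lies in `[0, #A * H]`.

The passage from polynomial growth to uniform convergence is general. Vectors that are pairwise far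
apart in Hamming distance are already separated by a few random coordinates, so the growth bound
yields packing numbers independent of the sample size (`card_le_exp_of_hammingDist`). Chaining over
nets at scales `4⁻ʲ`, with Hoeffding's inequality on each link, bounds the Rademacher sums uniformly
(`card_exists_lt_abs_rademacherSum_le`). Symmetrization with a ghost sample transfers the bound to
the deviations.

The supremum over `σ` is uncountable and the loss is discontinuous in `σ`. Measurability of the
symmetrized event holds because it comes from projections of `Fσ` sets in `σ`-compact spaces. -/

/-! ### Hoeffding's inequality by counting signs. -/

section Rademacher

variable {ι : Type*} [Fintype ι]

/-- The signed sum of the coordinates of `v`, with signs given by `e`. -/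
def rademacherSum (e : ι → Bool) (v : ι → ℝ) : ℝ :=
  ∑ k, if e k then v k else -v k

lemma rademacherSum_add (e : ι → Bool) (v w : ι → ℝ) :
    rademacherSum e (v + w) = rademacherSum e v + rademacherSum e w := by
  rw [rademacherSum, rademacherSum, rademacherSum, ← Finset.sum_add_distrib]
  refine Finset.sum_congr rfl fun k _ => ?_
  split_ifs
  · rfl
  · rw [Pi.add_apply]; ring

lemma rademacherSum_neg (e : ι → Bool) (v : ι → ℝ) :
    rademacherSum e (-v) = -rademacherSum e v := by
  rw [rademacherSum, rademacherSum, ← Finset.sum_neg_distrib]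
  refine Finset.sum_congr rfl fun k _ => ?_
  split_ifs <;> simp

variable [DecidableEq ι]

lemma sum_exp_rademacherSum (l : ℝ) (v : ι → ℝ) :
    ∑ e : ι → Bool, Real.exp (l * rademacherSum e v) = ∏ k, (2 * Real.cosh (l * v k)) := by
  have h : ∀ k, 2 * Real.cosh (l * v k) =
      ∑ b : Bool, Real.exp (l * if b then v k else -v k) := by
    intro k
    rw [Fintype.sum_bool, Real.cosh_eq]
    simp only [if_true, Bool.false_eq_true, if_false, mul_neg]
    ring
  simp_rw [h]
  rw [Finset.prod_univ_sum, Fintype.piFinset_univ]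
  refine Finset.sum_congr rfl fun e _ => ?_
  rw [rademacherSum, Finset.mul_sum, Real.exp_sum]

/-- Chernoff's method with `cosh x ≤ exp (x² / 2)`. The choice `l = t / W` is optimal and leaves the
exponent `l² W / 2 - l t = -c`. -/
lemma card_lt_rademacherSum_le {v : ι → ℝ} {W c : ℝ} (hW : 0 < W) (hc : 0 ≤ c)
    (hv : ∑ k, v k ^ 2 ≤ W) :
    ((Finset.univ.filter fun e : ι → Bool => √(2 * W * c) < rademacherSum e v).card : ℝ) ≤
      2 ^ Fintype.card ι * Real.exp (-c) := by
  set t := √(2 * W * c) with ht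
  have ht2 : t ^ 2 = 2 * W * c := Real.sq_sqrt (by positivity)
  set l := t / W with hl
  have hl0 : 0 ≤ l := div_nonneg (Real.sqrt_nonneg _) hW.le
  have h1 : ((Finset.univ.filter fun e : ι → Bool => t < rademacherSum e v).card : ℝ) *
      Real.exp (l * t) ≤ ∑ e : ι → Bool, Real.exp (l * rademacherSum e v) := by
    rw [← nsmul_eq_mul, ← Finset.sum_const]
    refine (Finset.sum_le_sum fun e he => ?_).trans
      (Finset.sum_le_sum_of_subset_of_nonneg (Finset.filter_subset _ _)
        fun _ _ _ => (Real.exp_pos _).le)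
    exact Real.exp_le_exp.2 (mul_le_mul_of_nonneg_left (Finset.mem_filter.1 he).2.le hl0)
  have h2 : ∏ k, (2 * Real.cosh (l * v k)) ≤ 2 ^ Fintype.card ι * Real.exp (l ^ 2 * W / 2) := by
    calc ∏ k, (2 * Real.cosh (l * v k)) ≤ ∏ k, (2 * Real.exp ((l * v k) ^ 2 / 2)) :=
          Finset.prod_le_prod (fun k _ => by positivity)
            fun k _ => by gcongr; exact Real.cosh_le_exp_half_sq _
      _ = 2 ^ Fintype.card ι * Real.exp (l ^ 2 * (∑ k, v k ^ 2) / 2) := by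
          rw [Finset.prod_mul_distrib, Finset.prod_const, Finset.card_univ, ← Real.exp_sum,
            Finset.mul_sum, Finset.sum_div]
          simp_rw [mul_pow]
      _ ≤ _ := by gcongr
  rw [sum_exp_rademacherSum] at h1
  have h3 := h1.trans h2
  rw [← le_div_iff₀ (Real.exp_pos _), mul_div_assoc, ← Real.exp_sub] at h3
  refine h3.trans_eq ?_
  congr 2
  have : l * W = t := by rw [hl]; field_simp
  have h4 : l * t = 2 * c := by
    rw [hl, div_mul_eq_mul_div, ← sq, ht2]; field_simp
  have h5 : l ^ 2 * W = 2 * c := by rw [sq, mul_assoc, this, h4]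
  linarith

/-- **Hoeffding's inequality** for Rademacher sums, as a count of sign vectors. -/
lemma card_lt_abs_rademacherSum_le {v : ι → ℝ} {W c : ℝ} (hW : 0 < W) (hc : 0 ≤ c)
    (hv : ∑ k, v k ^ 2 ≤ W) :
    ((Finset.univ.filter fun e : ι → Bool => √(2 * W * c) < |rademacherSum e v|).card : ℝ) ≤
      2 * (2 ^ Fintype.card ι * Real.exp (-c)) := by
  have h1 := card_lt_rademacherSum_le hW hc hv
  have h2 := card_lt_rademacherSum_le (v := -v) hW hc (by simpa using hv)
  have h3 : (Finset.univ.filter fun e : ι → Bool => √(2 * W * c) < |rademacherSum e v|) ⊆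
      (Finset.univ.filter fun e : ι → Bool => √(2 * W * c) < rademacherSum e v) ∪
      (Finset.univ.filter fun e : ι → Bool => √(2 * W * c) < rademacherSum e (-v)) := by
    intro e he
    simpa [lt_abs, rademacherSum_neg] using he
  have h4 : ((Finset.univ.filter fun e : ι → Bool =>
      √(2 * W * c) < |rademacherSum e v|).card : ℝ) ≤ _ :=
    Nat.cast_le.2 ((Finset.card_le_card h3).trans (Finset.card_union_le _ _))
  push_cast at h4
  linarith

end Rademacher

/-! ### Packing and covering numbers in Hamming distance. -/

section Packing

variable {ι T : Type*} [Fintype ι]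

lemma sum_sub_sq_le_hammingDist {B : ℝ} {u v : ι → ℝ} (hu : ∀ k, |u k| ≤ B)
    (hv : ∀ k, |v k| ≤ B) : ∑ k, (v k - u k) ^ 2 ≤ hammingDist u v * (2 * B) ^ 2 := by
  classical
  rw [hammingDist, ← nsmul_eq_mul, ← Finset.sum_const, Finset.sum_filter]
  refine Finset.sum_le_sum fun k _ => ?_
  split_ifs with h
  · rw [sq_le_sq, abs_of_nonneg (a := 2 * B) (by linarith [abs_nonneg (u k), hu k])]
    exact (abs_sub _ _).trans (by linarith [hu k, hv k])
  · rw [not_not.1 h]; simp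

/-- If the vectors `F t`, `t ∈ s`, pairwise differ in more than a fraction `ρ` of the coordinates,
then some `q` coordinates tell all of them apart, provided `q` is large. -/
lemma exists_injOn_of_hammingDist [Nonempty ι] (F : T → ι → ℝ) (s : Finset T) {ρ : ℝ}
    (hs : ∀ t ∈ s, ∀ t' ∈ s, t ≠ t' → ρ * Fintype.card ι < hammingDist (F t) (F t'))
    (q : ℕ) (hq : (s.card : ℝ) ^ 2 * Real.exp (-(ρ * q)) < 1) :
    ∃ x : Fin q → ι, Set.InjOn (fun t k => F t (x k)) (s : Set T) := by
  classical
  by_contra! hcon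
  set m := Fintype.card ι with hm
  have hm0 : (0 : ℝ) < m := by exact_mod_cast Fintype.card_pos
  -- Probabilistic method: a uniformly random `q`-tuple of coordinates fails to separate a given
  -- pair with probability at most `(1 - ρ) ^ q ≤ exp (-ρ q)`, and there are at most `s.card ^ 2`
  -- pairs.
  set bad : T × T → Finset (Fin q → ι) := fun p =>
    Fintype.piFinset fun _ => Finset.univ.filter fun k => F p.1 k = F p.2 k with hbad
  set pairs := (s ×ˢ s).filter fun p => p.1 ≠ p.2 with hpairs
  have hcov : (Finset.univ : Finset (Fin q → ι)) ⊆ pairs.biUnion bad := by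
    intro x _
    have := hcon x
    rw [Set.InjOn] at this
    push Not at this
    obtain ⟨t, ht, t', ht', he, hne⟩ := this
    refine Finset.mem_biUnion.2 ⟨(t, t'), by simp [hpairs, hne]; exact ⟨ht, ht'⟩, ?_⟩
    simp only [hbad, Fintype.mem_piFinset, Finset.mem_filter_univ]
    exact fun k => congrFun he k
  have hone : ∀ p ∈ pairs, ((bad p).card : ℝ) ≤ (m : ℝ) ^ q * Real.exp (-(ρ * q)) := by
    intro p hp
    simp only [hpairs, Finset.mem_filter, Finset.mem_product] at hp
    have h1 := hs p.1 hp.1.1 p.2 hp.1.2 hp.2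
    have h2 : (Finset.univ.filter fun k => F p.1 k = F p.2 k).card +
        hammingDist (F p.1) (F p.2) = m := by
      rw [hammingDist, hm, ← Finset.card_univ]
      exact Finset.card_filter_add_card_filter_not _
    have h3 : ((Finset.univ.filter fun k => F p.1 k = F p.2 k).card : ℝ) ≤
        m * Real.exp (-ρ) := by
      have h4 : ((Finset.univ.filter fun k => F p.1 k = F p.2 k).card : ℝ) +
        hammingDist (F p.1) (F p.2) = m := by exact_mod_cast h2
      have h5 := mul_le_mul_of_nonneg_left (Real.add_one_le_exp (-ρ)) hm0.le
      linarith
    rw [hbad, Fintype.card_piFinset]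
    simp only [Finset.prod_const, Finset.card_univ, Fintype.card_fin, Nat.cast_pow]
    calc _ ≤ ((m : ℝ) * Real.exp (-ρ)) ^ q := by gcongr
      _ = _ := by rw [mul_pow, ← Real.exp_nat_mul]; congr 2; ring
  have h1 : (m : ℝ) ^ q ≤ (s.card : ℝ) ^ 2 * ((m : ℝ) ^ q * Real.exp (-(ρ * q))) := by
    have h2 := (Finset.card_le_card hcov).trans Finset.card_biUnion_le
    rw [Finset.card_univ, Fintype.card_fun, Fintype.card_fin] at h2
    have h3 : ((m : ℝ) ^ q) ≤ ∑ p ∈ pairs, ((bad p).card : ℝ) := by exact_mod_cast h2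
    refine h3.trans ((Finset.sum_le_card_nsmul _ _ _ hone).trans ?_)
    rw [nsmul_eq_mul]
    gcongr
    have : pairs.card ≤ s.card ^ 2 := by
      rw [sq, ← Finset.card_product]
      exact Finset.card_filter_le _ _
    exact_mod_cast this
  have h2 : (0 : ℝ) < (m : ℝ) ^ q := by positivity
  nlinarith

/-- Packing numbers in Hamming distance of a family whose restrictions to `q` coordinates take at
most `(K q + 1) ^ D` values. -/
lemma card_le_exp_of_hammingDist [Nonempty ι] (F : T → ι → ℝ) {K D : ℕ} (hK : 1 ≤ K) (hD : 1 ≤ D)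
    (growth : ∀ (q : ℕ) (x : Fin q → ι) (s : Finset T),
      Set.InjOn (fun t k => F t (x k)) (s : Set T) → s.card ≤ (K * q + 1) ^ D)
    {M : ℝ} (hM1 : 2 * D * Real.log (8 * K * D) ≤ M) (hM2 : 2 * D * Real.log 4 ≤ M)
    (j : ℕ) (s : Finset T)
    (hs : ∀ t ∈ s, ∀ t' ∈ s, t ≠ t' →
      ((4 : ℝ) ^ j)⁻¹ * Fintype.card ι < hammingDist (F t) (F t')) :
    (s.card : ℝ) ≤ Real.exp (M * (j + 1)) := by
  rcases s.eq_empty_or_nonempty with rfl | hne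
  · simpa using (Real.exp_pos _).le
  have hn : (0 : ℝ) < s.card := by exact_mod_cast hne.card_pos
  have hn1 : (1 : ℝ) ≤ s.card := by exact_mod_cast hne.card_pos
  have hK' : (1 : ℝ) ≤ K := by exact_mod_cast hK
  have hD' : (1 : ℝ) ≤ D := by exact_mod_cast hD
  set L := Real.log s.card with hL
  have hL0 : 0 ≤ L := Real.log_nonneg hn1
  set R : ℝ := 4 ^ j with hR
  have hR1 : 1 ≤ R := one_le_pow₀ (by norm_num)
  -- Just above `2 L R`, the threshold for separation with `ρ = R⁻¹`.
  set q := ⌊2 * L * R⌋₊ + 1 with hqdef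
  have hq1 : 2 * L * R < q := by rw [hqdef]; push_cast; exact Nat.lt_floor_add_one _
  have hq2 : (q : ℝ) ≤ 2 * L * R + 1 := by
    rw [hqdef]; push_cast; linarith [Nat.floor_le (show 0 ≤ 2 * L * R by positivity)]
  obtain ⟨x, hx⟩ := exists_injOn_of_hammingDist F s hs q (by
    rw [← Real.exp_log hn, ← Real.exp_nat_mul, ← Real.exp_add, Real.exp_lt_one_iff]
    have : 2 * L < R⁻¹ * q := by
      rw [inv_mul_eq_div, lt_div_iff₀ (by positivity)]; exact hq1
    push_cast
    linarith)
  have h1 : (s.card : ℝ) ≤ (K * q + 1) ^ D := by exact_mod_cast growth q x s hx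
  have h2 : (K * q + 1 : ℝ) ≤ 4 * K * (L + 1) * R := by
    have : (K : ℝ) * q ≤ K * (2 * L * R + 1) := by gcongr
    have h3 : (1 : ℝ) ≤ K * R := one_le_mul_of_one_le_of_one_le hK' hR1
    have h4 : (K : ℝ) ≤ K * R := le_mul_of_one_le_right (by positivity) hR1
    have h5 : 0 ≤ (K : ℝ) * L * R := by positivity
    nlinarith
  have h3 : L ≤ D * (Real.log (4 * K) + Real.log (L + 1) + j * Real.log 4) := by
    have h4 : (s.card : ℝ) ≤ (4 * K * (L + 1) * R) ^ D := h1.trans (by gcongr)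
    have h5 := Real.log_le_log hn h4
    rwa [Real.log_pow, Real.log_mul (by positivity) (by positivity),
      Real.log_mul (by positivity) (by positivity), hR, Real.log_pow] at h5
  -- The growth bound controls `L` by `D log (L + 1)`. Applying `log x ≤ x - 1` at `x = (L + 1) / (2
  -- D)` lets half of `L` absorb this term.
  have h4 : Real.log (L + 1) ≤ (L + 1) / (2 * D) - 1 + Real.log (2 * D) := by
    have h5 := Real.log_le_sub_one_of_pos (show 0 < (L + 1) / (2 * D) by positivity)
    rw [Real.log_div (by positivity) (by positivity)] at h5
    linarith
  have h5 : (D : ℝ) * Real.log (L + 1) ≤ (L + 1) / 2 - D + D * Real.log (2 * D) := by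
    have h6 := mul_le_mul_of_nonneg_left h4 (show (0 : ℝ) ≤ D by positivity)
    have h7 : (D : ℝ) * ((L + 1) / (2 * D)) = (L + 1) / 2 := by field_simp
    nlinarith
  have h6 : Real.log (8 * K * D) = Real.log (4 * K) + Real.log (2 * D) := by
    rw [← Real.log_mul (by positivity) (by positivity)]; congr 1; ring
  have h7 : L ≤ M * (j + 1) := by
    have h8 := mul_le_mul_of_nonneg_right hM2 (show (0 : ℝ) ≤ j by positivity)
    rw [h6] at hM1
    nlinarith
  calc (s.card : ℝ) = Real.exp L := (Real.exp_log hn).symm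
    _ ≤ _ := Real.exp_le_exp.2 h7

/-- A maximal packing is a covering. -/
lemma exists_finset_hammingDist_le (F : T → ι → ℝ) {r b : ℝ} (hr : 0 ≤ r)
    (pack : ∀ s : Finset T, (∀ t ∈ s, ∀ t' ∈ s, t ≠ t' → r < hammingDist (F t) (F t')) →
      (s.card : ℝ) ≤ b) :
    ∃ s : Finset T, (s.card : ℝ) ≤ b ∧ ∀ t, ∃ a ∈ s, (hammingDist (F a) (F t) : ℝ) ≤ r := by
  classical
  set P : Finset T → Prop := fun s => ∀ t ∈ s, ∀ t' ∈ s, t ≠ t' → r < hammingDist (F t) (F t')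
  have hne : ({n | ∃ s, P s ∧ s.card = n} : Set ℕ).Nonempty := ⟨0, ∅, by simp [P], rfl⟩
  have hbdd : BddAbove {n | ∃ s, P s ∧ s.card = n} := by
    refine ⟨⌊b⌋₊, ?_⟩
    rintro n ⟨s, hs, rfl⟩
    exact Nat.le_floor (pack s hs)
  obtain ⟨s, hs, hcard⟩ := Nat.sSup_mem hne hbdd
  refine ⟨s, pack s hs, fun t => ?_⟩
  by_contra! hcon
  have hts : t ∉ s := by
    intro h
    have := hcon t h
    simp only [hammingDist_self, Nat.cast_zero] at this
    linarith
  have hins : P (insert t s) := by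
    intro u hu u' hu' hne
    rcases Finset.mem_insert.1 hu with h1 | h1 <;> rcases Finset.mem_insert.1 hu' with h2 | h2
    · exact absurd (h1.trans h2.symm) hne
    · rw [h1, hammingDist_comm]; exact hcon u' h2
    · rw [h2]; exact hcon u h1
    · exact hs u h1 u' h2 hne
  have := le_csSup hbdd ⟨insert t s, hins, rfl⟩
  rw [← hcard, Finset.card_insert_of_notMem hts] at this
  omega

end Packing

/-! ### Chaining and the maximal inequality. -/

section Chaining

variable {ι T : Type*} [Fintype ι]

lemma sum_add_one_mul_inv_two_pow (J : ℕ) :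
    ∑ j ∈ Finset.range J, ((j : ℝ) + 1) * (2 ^ j)⁻¹ ≤ 4 := by
  have h : ∑ j ∈ Finset.range J, ((j : ℝ) + 1) * (2 ^ j)⁻¹ = 4 - (2 * J + 4) * (2 ^ J)⁻¹ := by
    induction J with
    | zero => norm_num
    | succ n ih =>
      rw [Finset.sum_range_succ, ih, pow_succ, mul_inv]
      push_cast
      ring
  rw [h]
  have : 0 ≤ (2 * (J : ℝ) + 4) * (2 ^ J)⁻¹ := by positivity
  linarith

/-- **Chaining**: a union bound for links between nets at geometrically decreasing scales. -/
lemma exists_net_of_lt_rademacherSum [Nonempty ι] (F : T → ι → ℝ) {B c : ℝ} (hB : 0 ≤ B)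
    (hc : 0 ≤ c) (net : ℕ → Finset T)
    (hnet : ∀ j t, ∃ a ∈ net j, (hammingDist (F a) (F t) : ℝ) ≤ (4 ^ j)⁻¹ * Fintype.card ι)
    {J : ℕ} (hJ : Fintype.card ι < 4 ^ J) (e : ι → Bool)
    (h0 : ∀ a ∈ net 0, |rademacherSum e (F a)| ≤ √(2 * (B ^ 2 * Fintype.card ι) * c))
    (hlink : ∀ j < J, ∀ a ∈ net j, ∀ b ∈ net (j + 1),
      (hammingDist (F a) (F b) : ℝ) ≤ 2 * ((4 ^ j)⁻¹ * Fintype.card ι) →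
      |rademacherSum e (F b - F a)| ≤
        √(2 * (8 * B ^ 2 * ((4 ^ j)⁻¹ * Fintype.card ι)) * (c * (j + 1)))) (t : T) :
    |rademacherSum e (F t)| ≤ 18 * B * √(Fintype.card ι * c) := by
  set m : ℝ := (Fintype.card ι : ℝ) with hm
  have hm0 : 0 ≤ m := Nat.cast_nonneg _
  choose p hp hpd using fun j => hnet j t
  have hstep : ∀ j < J, |rademacherSum e (F (p (j + 1)))| ≤ |rademacherSum e (F (p j))| +
      4 * B * √(m * c) * ((j + 1) * (2 ^ j)⁻¹) := by
    intro j hj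
    have hd : (hammingDist (F (p j)) (F (p (j + 1))) : ℝ) ≤ 2 * ((4 ^ j)⁻¹ * m) := by
      have h1 : (hammingDist (F (p j)) (F (p (j + 1))) : ℝ) ≤
          hammingDist (F (p j)) (F t) + hammingDist (F (p (j + 1))) (F t) := by
        rw [hammingDist_comm (F (p (j + 1)))]
        exact_mod_cast hammingDist_triangle _ _ _
      have h2 : ((4 : ℝ) ^ (j + 1))⁻¹ * m ≤ (4 ^ j)⁻¹ * m := by
        gcongr
        · norm_num
        · omega
      linarith [hpd j, hpd (j + 1)]
    have h1 := hlink j hj _ (hp j) _ (hp (j + 1)) hd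
    have h2 : F (p (j + 1)) = F (p j) + (F (p (j + 1)) - F (p j)) := by abel
    -- The estimate `√(j + 1) ≤ j + 1` makes the level bounds summable in closed form: the links
    -- contribute `4 * 4 = 16` and the base net `2`, whence the constant `18`.
    have h3 : √(2 * (8 * B ^ 2 * ((4 ^ j)⁻¹ * m)) * (c * (j + 1))) ≤
        4 * B * √(m * c) * ((j + 1) * (2 ^ j)⁻¹) := by
      refine Real.sqrt_le_iff.2 ⟨by positivity, ?_⟩
      have h4 : ((2 : ℝ) ^ j)⁻¹ ^ 2 = (4 ^ j)⁻¹ := by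
        rw [inv_pow, ← pow_mul, mul_comm, pow_mul]; norm_num
      rw [mul_pow, mul_pow, mul_pow, mul_pow, h4, Real.sq_sqrt (by positivity)]
      have h5 : (j + 1 : ℝ) ≤ (j + 1) ^ 2 := by nlinarith [show (0 : ℝ) ≤ j by positivity]
      have h6 : 0 ≤ 16 * B ^ 2 * ((4 ^ j)⁻¹ * m) * c := by positivity
      nlinarith [mul_le_mul_of_nonneg_left h5 h6]
    rw [h2, rademacherSum_add]
    exact (abs_add_le _ _).trans (by linarith)
  have hsum : ∀ j ≤ J, |rademacherSum e (F (p j))| ≤ 2 * B * √(m * c) +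
      4 * B * √(m * c) * ∑ i ∈ Finset.range j, ((i : ℝ) + 1) * (2 ^ i)⁻¹ := by
    intro j
    induction j with
    | zero =>
      intro _
      refine (h0 _ (hp 0)).trans ?_
      simp only [Finset.range_zero, Finset.sum_empty, mul_zero, add_zero]
      refine Real.sqrt_le_iff.2 ⟨by positivity, ?_⟩
      rw [mul_pow, mul_pow, Real.sq_sqrt (by positivity)]
      have : 0 ≤ B ^ 2 * (m * c) := by positivity
      nlinarith
    | succ j ih =>
      intro hj
      rw [Finset.sum_range_succ, mul_add]
      linarith [ih (by omega), hstep j (by omega)]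
  -- At scale `J` the net distance is below `1`, so the approximation is exact and the chain is
  -- finite.
  have hlast : F (p J) = F t := by
    have h1 := hpd J
    have h2 : ((4 : ℝ) ^ J)⁻¹ * m < 1 := by
      rw [inv_mul_eq_div, div_lt_one (by positivity), hm]
      exact_mod_cast hJ
    have h3 : hammingDist (F (p J)) (F t) < 1 := by exact_mod_cast h1.trans_lt h2
    exact hammingDist_eq_zero.1 (by omega)
  rw [← hlast]
  refine (hsum J le_rfl).trans ?_
  have h1 := mul_le_mul_of_nonneg_left (sum_add_one_mul_inv_two_pow J)
    (show 0 ≤ 4 * B * √(m * c) by positivity)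
  linarith

open Classical in
/-- Maximal inequality for Rademacher sums indexed by a family with small packing numbers. -/
lemma card_exists_lt_abs_rademacherSum_le [DecidableEq ι] [Nonempty ι] (F : T → ι → ℝ)
    {B M η : ℝ} (hB : 0 < B) (hF : ∀ t k, |F t k| ≤ B) (hM : 0 ≤ M) (hη : 0 < η) (hη1 : η ≤ 1)
    (pack : ∀ (j : ℕ) (s : Finset T), (∀ t ∈ s, ∀ t' ∈ s, t ≠ t' →
      ((4 : ℝ) ^ j)⁻¹ * Fintype.card ι < hammingDist (F t) (F t')) →
      (s.card : ℝ) ≤ Real.exp (M * (j + 1))) :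
    ((Finset.univ.filter fun e : ι → Bool => ∃ t, 18 * B *
      √(Fintype.card ι * (3 * M + Real.log (16 / η))) < |rademacherSum e (F t)|).card : ℝ) ≤
      η / 2 * 2 ^ Fintype.card ι := by
  set m := Fintype.card ι with hm
  have hm0 : (0 : ℝ) < m := by exact_mod_cast Fintype.card_pos
  -- Level `j` has at most `exp (M (j + 1) + M (j + 2)) ≤ exp (3 M (j + 1))` links, which the term
  -- `3 M` pays for. The logarithm leaves `(η / 16) ^ (j + 1)` per level; base and links then sum to
  -- `6 η / 16 ≤ η / 2`.
  set c := 3 * M + Real.log (16 / η) with hc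
  have hc0 : 0 ≤ c := add_nonneg (by positivity) (Real.log_nonneg (by
    rw [le_div_iff₀ hη]; linarith))
  choose net hcard hnet using fun j : ℕ =>
    exists_finset_hammingDist_le F (r := ((4 : ℝ) ^ j)⁻¹ * m) (by positivity) (pack j)
  set J := m with hJdef
  have hJ : m < 4 ^ J := Nat.lt_pow_self (by norm_num)
  set B0 : T → Finset (ι → Bool) := fun a => Finset.univ.filter fun e =>
    √(2 * (B ^ 2 * m) * c) < |rademacherSum e (F a)| with hB0
  set B1 : ℕ → T × T → Finset (ι → Bool) := fun j p => Finset.univ.filter fun e =>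
    √(2 * (8 * B ^ 2 * ((4 ^ j)⁻¹ * m)) * (c * (j + 1))) < |rademacherSum e (F p.2 - F p.1)|
    with hB1
  set links : ℕ → Finset (T × T) := fun j => (net j ×ˢ net (j + 1)).filter fun p =>
    (hammingDist (F p.1) (F p.2) : ℝ) ≤ 2 * ((4 ^ j)⁻¹ * m) with hlinks
  have hcov : (Finset.univ.filter fun e : ι → Bool => ∃ t, 18 * B *
      √(m * c) < |rademacherSum e (F t)|) ⊆
      (net 0).biUnion B0 ∪ (Finset.range J).biUnion fun j => (links j).biUnion (B1 j) := by
    intro e he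
    obtain ⟨t, ht⟩ := (Finset.mem_filter.1 he).2
    by_contra hcon
    rw [Finset.mem_union, not_or] at hcon
    refine absurd (exists_net_of_lt_rademacherSum F hB.le hc0 net hnet hJ e ?_ ?_ t) (not_le.2 ht)
    · intro a ha
      by_contra! h
      exact hcon.1 (Finset.mem_biUnion.2 ⟨a, ha, by simpa [hB0] using h⟩)
    · intro j hj a ha b hb hd
      by_contra! h
      refine hcon.2 (Finset.mem_biUnion.2 ⟨j, Finset.mem_range.2 hj, Finset.mem_biUnion.2
        ⟨(a, b), ?_, by simpa [hB1] using h⟩⟩)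
      simp only [hlinks, Finset.mem_filter, Finset.mem_product]
      exact ⟨⟨ha, hb⟩, hd⟩
  have hexp : ∀ j : ℕ, Real.exp (-(c * (j + 1))) =
      Real.exp (-(3 * M * (j + 1))) * (η / 16) ^ (j + 1) := by
    intro j
    have h1 : η / 16 = Real.exp (-Real.log (16 / η)) := by
      rw [Real.exp_neg, Real.exp_log (by positivity), inv_div]
    rw [h1, ← Real.exp_nat_mul, ← Real.exp_add, hc]
    congr 1
    push_cast
    ring
  have h0 : (((net 0).biUnion B0).card : ℝ) ≤ 2 * 2 ^ m * (η / 16) := by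
    have h1 : ∀ a ∈ net 0, ((B0 a).card : ℝ) ≤ 2 * (2 ^ m * Real.exp (-c)) := fun a _ =>
      card_lt_abs_rademacherSum_le (by positivity) hc0 (by
        refine (Finset.sum_le_card_nsmul _ _ (B ^ 2) fun k _ => sq_le_sq.2 ?_).trans_eq
          (by rw [nsmul_eq_mul, Finset.card_univ, mul_comm])
        rw [abs_of_pos hB]; exact hF a k)
    have h2 : (((net 0).biUnion B0).card : ℝ) ≤ ∑ a ∈ net 0, ((B0 a).card : ℝ) := by
      exact_mod_cast Finset.card_biUnion_le
    refine h2.trans ((Finset.sum_le_card_nsmul _ _ _ h1).trans ?_)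
    rw [nsmul_eq_mul]
    have h3 := hcard 0
    have h4 := hexp 0
    simp only [Nat.cast_zero, zero_add, mul_one, pow_one] at h3 h4
    have h5 : Real.exp M * Real.exp (-(3 * M)) ≤ 1 := by
      rw [← Real.exp_add, Real.exp_le_one_iff]; linarith
    rw [h4]
    calc _ ≤ Real.exp M * (2 * (2 ^ m * (Real.exp (-(3 * M)) * (η / 16)))) := by gcongr
      _ = (Real.exp M * Real.exp (-(3 * M))) * (2 * 2 ^ m * (η / 16)) := by ring
      _ ≤ _ := mul_le_of_le_one_left (by positivity) h5
  have hj : ∀ j ∈ Finset.range J, (((links j).biUnion (B1 j)).card : ℝ) ≤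
      2 * 2 ^ m * (η / 16) * (1 / 2) ^ j := by
    intro j _
    have h1 : ∀ p ∈ links j, ((B1 j p).card : ℝ) ≤
        2 * (2 ^ m * Real.exp (-(c * (j + 1)))) := by
      intro p hp
      simp only [hlinks, Finset.mem_filter] at hp
      refine card_lt_abs_rademacherSum_le (by positivity) (by positivity) ?_
      refine (sum_sub_sq_le_hammingDist (hF p.1) (hF p.2)).trans ?_
      refine (mul_le_mul_of_nonneg_right hp.2 (by positivity)).trans_eq (by ring)
    have h2 : (((links j).biUnion (B1 j)).card : ℝ) ≤ ∑ p ∈ links j, ((B1 j p).card : ℝ) := by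
      exact_mod_cast Finset.card_biUnion_le
    refine h2.trans ((Finset.sum_le_card_nsmul _ _ _ h1).trans ?_)
    rw [nsmul_eq_mul, hexp]
    have h3 : ((links j).card : ℝ) ≤ Real.exp (M * (j + 1)) * Real.exp (M * (j + 1 + 1)) := by
      have h4 : ((links j).card : ℝ) ≤ (net j).card * (net (j + 1)).card := by
        rw [← Nat.cast_mul, ← Finset.card_product]
        exact_mod_cast Finset.card_filter_le _ _
      refine h4.trans (mul_le_mul (hcard j) ?_ (by positivity) (by positivity))
      have := hcard (j + 1)
      push_cast at this
      exact this
    have h5 : Real.exp (M * (j + 1)) * Real.exp (M * (j + 1 + 1)) *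
        Real.exp (-(3 * M * (j + 1))) ≤ 1 := by
      rw [← Real.exp_add, ← Real.exp_add, Real.exp_le_one_iff]
      nlinarith [show 0 ≤ M * j by positivity]
    have h6 : (η / 16) ^ (j + 1) ≤ η / 16 * (1 / 2) ^ j := by
      rw [pow_succ, mul_comm]
      gcongr
      linarith
    calc _ ≤ Real.exp (M * (j + 1)) * Real.exp (M * (j + 1 + 1)) *
          (2 * (2 ^ m * (Real.exp (-(3 * M * (j + 1))) * (η / 16 * (1 / 2) ^ j)))) := by gcongr
      _ = Real.exp (M * (j + 1)) * Real.exp (M * (j + 1 + 1)) *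
          Real.exp (-(3 * M * (j + 1))) * (2 * 2 ^ m * (η / 16) * (1 / 2) ^ j) := by ring
      _ ≤ _ := mul_le_of_le_one_left (by positivity) h5
  have h1 : ((((Finset.range J).biUnion fun j => (links j).biUnion (B1 j)).card : ℕ) : ℝ) ≤
      2 * 2 ^ m * (η / 16) * 2 := by
    have h2 : ((((Finset.range J).biUnion fun j => (links j).biUnion (B1 j)).card : ℕ) : ℝ) ≤
        ∑ j ∈ Finset.range J, (((links j).biUnion (B1 j)).card : ℝ) := by
      exact_mod_cast Finset.card_biUnion_le
    refine h2.trans ((Finset.sum_le_sum hj).trans ?_)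
    rw [← Finset.mul_sum]
    gcongr
    exact sum_geometric_two_le J
  have h2 := Nat.cast_le (α := ℝ).2 ((Finset.card_le_card hcov).trans (Finset.card_union_le _ _))
  push_cast at h2
  have h3 : 0 < (2 : ℝ) ^ m * η := by positivity
  linarith

end Chaining

/-! ### Symmetrization and uniform convergence. -/

section Symmetrization

variable {ι X T : Type*} [Fintype ι] [MeasurableSpace X]

lemma measurePreserving_ite_swap (D : Measure X) [IsProbabilityMeasure D] (e : ι → Bool) :
    MeasurePreserving (fun (z : ι → X × X) k => if e k then z k else (z k).swap)
      (Measure.pi fun _ => D.prod D) (Measure.pi fun _ => D.prod D) := by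
  refine measurePreserving_pi (fun _ => D.prod D) (fun _ => D.prod D)
    (f := fun k p => if e k then p else p.swap) fun k => ?_
  cases e k
  · exact Measure.measurePreserving_swap
  · exact MeasurePreserving.id _

open Classical in
/-- Symmetrization by random swaps of the two samples. -/
lemma measure_exists_lt_abs_sum_sub_le [DecidableEq ι] (D : Measure X) [IsProbabilityMeasure D]
    (f : T → X → ℝ) {c p : ℝ}
    (hmeas : MeasurableSet {z : ι → X × X | ∃ t, c < |∑ k, (f t (z k).1 - f t (z k).2)|})
    (hp : ∀ z : ι → X × X, ((Finset.univ.filter fun e : ι → Bool => ∃ t,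
      c < |rademacherSum e fun k => f t (z k).1 - f t (z k).2|).card : ℝ) ≤
        p * 2 ^ Fintype.card ι) :
    (Measure.pi fun _ : ι => D.prod D) {z | ∃ t, c < |∑ k, (f t (z k).1 - f t (z k).2)|} ≤
      ENNReal.ofReal p := by
  set Q := Measure.pi fun _ : ι => D.prod D with hQ
  set bad := {z : ι → X × X | ∃ t, c < |∑ k, (f t (z k).1 - f t (z k).2)|} with hbad
  set sw : (ι → Bool) → (ι → X × X) → ι → X × X :=
    fun e z k => if e k then z k else (z k).swap with hsw
  have hpre : ∀ e, MeasurePreserving (sw e) Q Q := measurePreserving_ite_swap D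
  have hmem : ∀ e z, sw e z ∈ bad ↔
      ∃ t, c < |rademacherSum e fun k => f t (z k).1 - f t (z k).2| := by
    intro e z
    have : ∀ t, ∑ k, (f t (sw e z k).1 - f t (sw e z k).2) =
        rademacherSum e fun k => f t (z k).1 - f t (z k).2 := by
      intro t
      refine Finset.sum_congr rfl fun k _ => ?_
      simp only [hsw]
      split_ifs <;> simp
    simp only [hbad, Set.mem_ofPred_eq, this]
  -- Every swap preserves `Q`, so the measure of `bad` is the average over sign vectors of the
  -- swapped events. For fixed `z` that average is the count bounded by `hp`.
  have h1 : (2 : ENNReal) ^ Fintype.card ι * Q bad =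
      ∫⁻ z, ∑ e : ι → Bool, (sw e ⁻¹' bad).indicator 1 z ∂Q := by
    rw [lintegral_finsetSum _ fun e _ =>
      measurable_one.indicator ((hpre e).measurable hmeas)]
    simp_rw [lintegral_indicator_one ((hpre _).measurable hmeas),
      (hpre _).measure_preimage hmeas.nullMeasurableSet]
    simp
  have h2 : ∀ z, ∑ e : ι → Bool, (sw e ⁻¹' bad).indicator (1 : (ι → X × X) → ENNReal) z ≤
      ENNReal.ofReal p * 2 ^ Fintype.card ι := by
    intro z
    have h3 : ∑ e : ι → Bool, (sw e ⁻¹' bad).indicator (1 : (ι → X × X) → ENNReal) z =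
        ((Finset.univ.filter fun e : ι → Bool => ∃ t,
          c < |rademacherSum e fun k => f t (z k).1 - f t (z k).2|).card : ENNReal) := by
      rw [Finset.card_filter, Nat.cast_sum]
      refine Finset.sum_congr rfl fun e _ => ?_
      simp only [Set.indicator_apply, Set.mem_preimage, hmem]
      split_ifs <;> simp
    rw [h3, ← ENNReal.ofReal_natCast]
    refine (ENNReal.ofReal_le_ofReal (hp z)).trans_eq ?_
    rw [ENNReal.ofReal_mul' (by positivity), ENNReal.ofReal_pow (by norm_num)]
    norm_num
  have h3 : (2 : ENNReal) ^ Fintype.card ι * Q bad ≤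
      2 ^ Fintype.card ι * ENNReal.ofReal p := by
    rw [h1, mul_comm _ (ENNReal.ofReal p)]
    refine (lintegral_mono h2).trans_eq ?_
    simp
  exact (ENNReal.mul_le_mul_iff_right (by positivity) (by finiteness)).1 h3

/-- Chebyshev's inequality for the empirical sum of a bounded function. -/
lemma measure_le_abs_sum_sub_le (D : Measure X) [IsProbabilityMeasure D] {g : X → ℝ}
    (hg : Measurable g) {B c : ℝ} (hB : ∀ x, g x ∈ Set.Icc 0 B) (hc : 0 < c) :
    (Measure.pi fun _ : ι => D) {S | c ≤ |∑ k, g (S k) - Fintype.card ι * ∫ x, g x ∂D|} ≤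
      ENNReal.ofReal (Fintype.card ι * (B / 2) ^ 2 / c ^ 2) := by
  have hmem : MemLp g 2 D :=
    memLp_of_bounded (Filter.Eventually.of_forall hB) hg.aestronglyMeasurable 2
  have hmemk : ∀ k : ι, MemLp (fun S : ι → X => g (S k)) 2 (Measure.pi fun _ => D) := fun k =>
    hmem.comp_measurePreserving (measurePreserving_eval (fun _ : ι => D) k)
  have hint : ∫ S : ι → X, (∑ k, fun S : ι → X => g (S k)) S ∂(Measure.pi fun _ => D) =
      Fintype.card ι * ∫ x, g x ∂D := by
    simp only [Finset.sum_apply]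
    rw [integral_finsetSum _ fun k _ => (hmemk k).integrable (by norm_num)]
    have : ∀ k : ι, ∫ S : ι → X, g (S k) ∂(Measure.pi fun _ => D) = ∫ x, g x ∂D := fun k => by
      have h := measurePreserving_eval (fun _ : ι => D) k
      have h1 := integral_map h.measurable.aemeasurable (f := g)
        (by rw [h.map_eq]; exact hg.aestronglyMeasurable)
      rw [h.map_eq] at h1
      exact h1.symm
    simp [this]
  have h1 := ProbabilityTheory.meas_ge_le_variance_div_sq
    (memLp_finsetSum' Finset.univ fun k _ => hmemk k) hc
  rw [hint, ProbabilityTheory.variance_sum_pi (X := fun _ : ι => g) fun _ => hmem] at h1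
  simp only [Finset.sum_apply] at h1
  refine h1.trans (ENNReal.ofReal_le_ofReal ?_)
  gcongr
  rw [Finset.sum_const, nsmul_eq_mul, Finset.card_univ]
  gcongr
  simpa using ProbabilityTheory.variance_le_sq_of_bounded (Filter.Eventually.of_forall hB)
    hg.aemeasurable

/-- **Uniform convergence** without a logarithmic factor, for a family of bounded functions whose
restrictions to `n` points take at most `(K n + 1) ^ D` values. -/
theorem exists_measurableSet_forall_abs_average_sub_integral_le [Nonempty ι] (D : Measure X)
    [IsProbabilityMeasure D] (f : T → X → ℝ) {B : ℝ} (hB : 0 < B)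
    (hf : ∀ t, Measurable (f t)) (hfB : ∀ t x, f t x ∈ Set.Icc 0 B) {K d : ℕ} (hK : 1 ≤ K)
    (hd : 1 ≤ d)
    (growth : ∀ (κ : Type) [Fintype κ] (x : κ → X) (s : Finset T),
      Set.InjOn (fun t k => f t (x k)) (s : Set T) → s.card ≤ (K * Fintype.card κ + 1) ^ d)
    (hmeas : ∀ c : ℝ, MeasurableSet
      {z : ι → X × X | ∃ t, c < |∑ k, (f t (z k).1 - f t (z k).2)|})
    {M ε δ : ℝ} (hM1 : 2 * d * Real.log (16 * K * d) ≤ M) (hM2 : 2 * d * Real.log 4 ≤ M)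
    (hε : 0 < ε) (hδ : 0 < δ) (hδ1 : δ ≤ 1)
    (hm : 5184 * B ^ 2 * (3 * M + Real.log (16 / δ)) ≤ Fintype.card ι * ε ^ 2) :
    ∃ E : Set (ι → X), MeasurableSet E ∧ ENNReal.ofReal (1 - δ) ≤ Measure.pi (fun _ => D) E ∧
      ∀ S ∈ E, ∀ t, |(∑ k, f t (S k)) / Fintype.card ι - ∫ x, f t x ∂D| ≤ ε / 2 := by
  classical
  set m := Fintype.card ι with hmdef
  have hm0 : (0 : ℝ) < m := by exact_mod_cast Fintype.card_pos
  have hM0 : 0 ≤ M := le_trans (by positivity) hM2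
  have hlog : 1 ≤ Real.log (16 / δ) := by
    rw [Real.le_log_iff_exp_le (by positivity), le_div_iff₀ hδ]
    nlinarith [Real.exp_one_lt_d9, Real.exp_pos 1]
  set c := 18 * B * √(m * (3 * M + Real.log (16 / δ))) with hc
  -- Here `5184 = 72 ^ 2` and `72 = 4 * 18`, with `18` the chaining constant.
  have hcle : c ≤ m * ε / 4 := by
    have h1 : √(m * (3 * M + Real.log (16 / δ))) ≤ m * ε / (72 * B) := by
      refine Real.sqrt_le_iff.2 ⟨by positivity, ?_⟩
      rw [div_pow, le_div_iff₀ (by positivity)]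
      nlinarith
    calc c ≤ 18 * B * (m * ε / (72 * B)) := by rw [hc]; gcongr
      _ = m * ε / 4 := by field_simp; norm_num
  set bad := {z : ι → X × X | ∃ t, c < |∑ k, (f t (z k).1 - f t (z k).2)|} with hbad
  have hbound : (Measure.pi fun _ : ι => D.prod D) bad ≤ ENNReal.ofReal (δ / 2) := by
    refine measure_exists_lt_abs_sum_sub_le D f (hmeas c) fun z => ?_
    refine card_exists_lt_abs_rademacherSum_le (fun t k => f t (z k).1 - f t (z k).2) hB
      (fun t k => abs_le.2 ?_) hM0 hδ hδ1 fun j s hs => ?_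
    · have h1 := hfB t (z k).1
      have h2 := hfB t (z k).2
      exact ⟨by linarith [h1.1, h2.2], by linarith [h1.2, h2.1]⟩
    -- A difference at `q` coordinates is determined by the values of `f` at `2 q` points, hence the
    -- doubled `K`.
    · refine card_le_exp_of_hammingDist (K := 2 * K) (D := d) _ (by omega) hd
        (fun q x s hs => ?_) (by push_cast; convert hM1 using 3; ring) hM2 j s hs
      have h1 := growth (Fin q ⊕ Fin q)
        (Sum.elim (fun k => (z (x k)).1) fun k => (z (x k)).2) s fun t ht t' ht' he => ?_
      · simp only [Fintype.card_sum, Fintype.card_fin] at h1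
        convert h1 using 2
        ring
      · refine hs ht ht' (funext fun k => ?_)
        have h2 := congrFun he (Sum.inl k)
        have h3 := congrFun he (Sum.inr k)
        simp only [Sum.elim_inl, Sum.elim_inr] at h2 h3
        simp only [h2, h3]
  have hpre := (measurePreserving_arrowProdEquivProdArrow X X ι (fun _ => D) fun _ => D).symm
  set bad2 := (MeasurableEquiv.arrowProdEquivProdArrow X X ι).symm ⁻¹' bad with hbad2
  have hbad2m : MeasurableSet bad2 := hpre.measurable (hmeas c)
  have hbound2 : ((Measure.pi fun _ : ι => D).prod (Measure.pi fun _ : ι => D)) bad2 ≤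
      ENNReal.ofReal (δ / 2) := by
    rw [hbad2, hpre.measure_preimage (hmeas c).nullMeasurableSet]
    exact hbound
  set P := Measure.pi fun _ : ι => D with hP
  have hsec : Measurable fun S => P (Prod.mk S ⁻¹' bad2) := measurable_measure_prodMk_left hbad2m
  -- Defining the good event through the ghost sample needs measurability only of the symmetrized
  -- event: sections of a measurable set have measurable mass. Markov's inequality bounds the
  -- complement by `2 * (δ / 2)`.
  set E := {S | P (Prod.mk S ⁻¹' bad2) < 2⁻¹} with hE
  have hEm : MeasurableSet E := measurableSet_lt hsec measurable_const
  refine ⟨E, hEm, ?_, fun S hS t => ?_⟩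
  · have h1 : P Eᶜ ≤ ENNReal.ofReal δ := by
      have h2 := mul_meas_ge_le_lintegral hsec 2⁻¹ (μ := P)
      rw [← Measure.prod_apply hbad2m] at h2
      have h3 : Eᶜ = {S | 2⁻¹ ≤ P (Prod.mk S ⁻¹' bad2)} := by
        ext S; simp [hE]
      rw [h3]
      have h4 := mul_le_mul_right (h2.trans hbound2) 2
      rw [← mul_assoc, ENNReal.mul_inv_cancel (by norm_num) (by norm_num), one_mul] at h4
      refine h4.trans_eq ?_
      rw [← ENNReal.ofReal_ofNat 2, ← ENNReal.ofReal_mul (by norm_num)]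
      congr 1
      ring
    rw [ENNReal.ofReal_sub _ hδ.le, ENNReal.ofReal_one, tsub_le_iff_right]
    calc (1 : ENNReal) = P Set.univ := measure_univ.symm
      _ = P E + P Eᶜ := (measure_add_measure_compl hEm).symm
      _ ≤ _ := by gcongr
  · by_contra! hcon
    set μ := ∫ x, f t x ∂D with hμ
    have hcon' : m * ε / 2 < |∑ k, f t (S k) - m * μ| := by
      have h1 : (∑ k, f t (S k)) / m - μ = (∑ k, f t (S k) - m * μ) / m := by
        field_simp
      rw [h1, abs_div, abs_of_pos hm0, lt_div_iff₀ hm0] at hcon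
      linarith
    -- If `S` deviates by more than `m ε / 2`, a ghost sample outside the bad section must itself
    -- deviate by `m ε / 4`. By Chebyshev this has probability at most `1 / 4`, although the
    -- complement of the section has mass above `1 / 2`.
    have h1 : (Prod.mk S ⁻¹' bad2)ᶜ ⊆ {S' | m * ε / 4 ≤ |∑ k, f t (S' k) - m * μ|} := by
      intro S' hS'
      by_contra! h
      refine hS' ⟨t, ?_⟩
      rw [Set.mem_ofPred_eq, not_le] at h
      have h2 : ∑ k, (f t (((MeasurableEquiv.arrowProdEquivProdArrow X X ι).symm (S, S')) k).1 -
          f t (((MeasurableEquiv.arrowProdEquivProdArrow X X ι).symm (S, S')) k).2) =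
          (∑ k, f t (S k) - m * μ) - (∑ k, f t (S' k) - m * μ) := by
        rw [Finset.sum_sub_distrib, sub_sub_sub_cancel_right]
        rfl
      rw [h2]
      have h3 := abs_sub_abs_le_abs_sub (∑ k, f t (S k) - m * μ) (∑ k, f t (S' k) - m * μ)
      linarith
    have h2 : P (Prod.mk S ⁻¹' bad2)ᶜ ≤ ENNReal.ofReal (1 / 4) := by
      refine (measure_mono h1).trans ((measure_le_abs_sum_sub_le D (hf t) (hfB t)
        (by positivity)).trans (ENNReal.ofReal_le_ofReal ?_))
      rw [div_le_iff₀ (by positivity)]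
      have h3 : 5184 * B ^ 2 ≤ m * ε ^ 2 := by nlinarith [sq_nonneg B]
      nlinarith [mul_le_mul_of_nonneg_left h3 hm0.le]
    have h3 : (1 : ENNReal) < ENNReal.ofReal 1 := by
      calc (1 : ENNReal) = P Set.univ := measure_univ.symm
        _ = P (Prod.mk S ⁻¹' bad2) + P (Prod.mk S ⁻¹' bad2)ᶜ :=
            (measure_add_measure_compl (measurable_prodMk_left hbad2m)).symm
        _ < 2⁻¹ + ENNReal.ofReal (1 / 2) := by
            refine ENNReal.add_lt_add_of_lt_of_le (by finiteness) hS (h2.trans ?_)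
            exact ENNReal.ofReal_le_ofReal (by norm_num)
        _ = ENNReal.ofReal 1 := by
            rw [show (2⁻¹ : ENNReal) = ENNReal.ofReal (1 / 2) by
              rw [one_div, ENNReal.ofReal_inv_of_pos (by norm_num), ENNReal.ofReal_ofNat],
              ← ENNReal.ofReal_add (by norm_num) (by norm_num)]
            norm_num
    simp at h3

end Symmetrization

/-! ### Counting sign patterns of affine functionals. -/

section SignPatterns

variable {P A T : Type*} [Fintype P] [Fintype A]

lemma sum_choose_le_pow {n d v : ℕ} (hv : v ≤ d) :
    ∑ k ∈ Finset.Iic v, n.choose k ≤ (n + 1) ^ d := by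
  rw [add_pow]
  have h : Finset.Iic v ⊆ Finset.range (d + 1) := fun k hk => by
    simp only [Finset.mem_Iic, Finset.mem_range] at *; omega
  refine (Finset.sum_le_sum_of_subset h).trans (Finset.sum_le_sum fun k hk => ?_)
  rw [one_pow, mul_one]
  exact (Nat.choose_le_pow n k).trans (Nat.le_mul_of_pos_right _ (Nat.choose_pos (by
    simp only [Finset.mem_range] at hk; omega)))

open Classical in
/-- Affine functionals `σ ↦ ∑ a, u p a * σ a + b p` on `A → ℝ` have at most
`(#P + 1) ^ (#A + 1)` patterns of nonnegativity. -/
lemma card_le_of_injOn_nonneg_pattern (u : P → A → ℝ) (b : P → ℝ) (σ : T → A → ℝ) (s : Finset T)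
    (hs : Set.InjOn (fun t => Finset.univ.filter fun p => 0 ≤ ∑ a, u p a * σ t a + b p)
      (s : Set T)) :
    s.card ≤ (Fintype.card P + 1) ^ (Fintype.card A + 1) := by
  set pat : T → Finset P := fun t => Finset.univ.filter fun p => 0 ≤ ∑ a, u p a * σ t a + b p
    with hpat
  rw [← Finset.card_image_of_injOn hs]
  refine (Finset.card_le_card_shatterer _).trans
    (Finset.card_shatterer_le_sum_vcDim.trans (sum_choose_le_pow ?_))
  refine Finset.sup_le fun r hr => ?_
  rw [Finset.mem_shatterer] at hr
  by_contra! hcard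
  set w : r → Option A → ℝ := fun p o => o.elim (b p) (u p) with hw
  have hdep : ¬LinearIndependent ℝ w := fun h => by
    have := h.fintype_card_le_finrank
    simp only [Fintype.card_coe, Module.finrank_fintype_fun_eq_card, Fintype.card_option] at this
    omega
  -- A shattered set larger than `#A + 1` carries a linear relation `l`. Shattering realizes the
  -- signs of `l` by some `σ`, so every term of `∑ p, l p * h p` is nonnegative although the sum
  -- vanishes. A pattern records `0 ≤ h`, so only a negative `l i` forces a strictly positive term;
  -- hence the possible change of sign.
  obtain ⟨l, hl, i, hi⟩ : ∃ l : r → ℝ, ∑ p, l p • w p = 0 ∧ ∃ i, l i < 0 := by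
    obtain ⟨l, hl, i, hi⟩ := Fintype.not_linearIndependent_iff.1 hdep
    rcases lt_or_gt_of_ne hi with h | h
    · exact ⟨l, hl, i, h⟩
    · refine ⟨-l, ?_, i, by simpa using h⟩
      simpa using hl
  obtain ⟨t, ht, htr⟩ := hr (t := r.filter fun p => ∃ h : p ∈ r, 0 ≤ l ⟨p, h⟩)
    (Finset.filter_subset _ _)
  obtain ⟨τ, -, rfl⟩ := Finset.mem_image.1 ht
  set h : r → ℝ := fun p => ∑ a, u p a * σ τ a + b p with hh
  have hiff : ∀ p : r, 0 ≤ h p ↔ 0 ≤ l p := by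
    intro p
    have := Finset.ext_iff.1 htr p
    simpa [hpat, hh] using this
  have hsum : ∑ p, l p * h p = 0 := by
    have h1 : ∀ o, ∑ p, l p * w p o = 0 := fun o => by
      have := congrFun hl o
      simpa using this
    have h2 : ∀ p, l p * h p = (∑ a, l p * w p (some a) * σ τ a) + l p * w p none := by
      intro p
      simp only [hh, hw, Option.elim, mul_add, Finset.mul_sum, mul_assoc]
    simp_rw [h2, Finset.sum_add_distrib, h1 none, add_zero]
    rw [Finset.sum_comm]
    simp_rw [← Finset.sum_mul, h1, zero_mul, Finset.sum_const_zero]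
  have hpos : 0 < ∑ p, l p * h p := by
    refine Finset.sum_pos' (fun p _ => ?_) ⟨i, Finset.mem_univ _, ?_⟩
    · by_cases hp : 0 ≤ l p
      · exact mul_nonneg hp ((hiff p).2 hp)
      · exact mul_nonneg_of_nonpos_of_nonpos (not_le.1 hp).le
          (not_le.1 fun h0 => hp ((hiff p).1 h0)).le
    · exact mul_pos_of_neg_of_neg hi (not_le.1 fun h0 => not_le.2 hi ((hiff i).1 h0))
  exact hpos.ne' hsum

end SignPatterns

/-! ### Range and growth of the losses. -/

namespace CostSharingGame

variable {N : ℕ} {A : Type*} {H : ℝ} [DecidableEq A]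

lemma users_pos (s : Fin N → A) (i : Fin N) : 0 < users s (s i) :=
  Finset.card_pos.2 ⟨i, by simp⟩

/-- Indexing the denominators `1, …, N` by `Fin N` keeps the number of comparisons polynomial. -/
lemma exists_users_eq (s : Fin N → A) (i : Fin N) : ∃ k : Fin N, (users s (s i) : ℝ) = k + 1 := by
  have h1 := users_pos s i
  have h2 : users s (s i) ≤ N := (Finset.card_filter_le _ _).trans (by simp)
  refine ⟨⟨users s (s i) - 1, by omega⟩, ?_⟩
  rw [← Nat.cast_add_one]
  congr 1
  exact (Nat.sub_add_cancel h1).symm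

/-- Subsidies cancel, so `σ` influences the loss only through the set of equilibria. -/
lemma totalCost_eq_sum_agentCost (G : CostSharingGame N A H) (σ : A → ℝ) (s : Fin N → A) :
    G.totalCost σ s = ∑ i, G.agentCost s i := by
  simp [totalCost, subsidizedCost]

/-- The loss depends on the subsidies only through the comparisons of the possible cost shares. -/
lemma loss_congr (G : CostSharingGame N A H) {σ τ : A → ℝ}
    (h : ∀ (a b : A) (i j : Fin N),
      (G.meanCost a - σ a) / (i + 1) ≤ (G.meanCost b - σ b) / (j + 1) ↔
      (G.meanCost a - τ a) / (i + 1) ≤ (G.meanCost b - τ b) / (j + 1)) :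
    G.loss σ = G.loss τ := by
  have hiff : ∀ s, G.IsNash σ s ↔ G.IsNash τ s := by
    intro s
    refine and_congr Iff.rfl (forall_congr' fun i => forall_congr' fun a => imp_congr Iff.rfl ?_)
    obtain ⟨k, hk⟩ := exists_users_eq s i
    obtain ⟨l, hl⟩ := exists_users_eq (Function.update s i a) i
    simp only [subsidizedCost, agentCost, agentSubsidy, hk, hl, ← sub_div]
    exact h _ _ _ _
  simp only [loss, hiff, totalCost_eq_sum_agentCost]

variable [Fintype A]

/-- The users of an action together pay its mean cost once, so the range scales with `#A` and not
with `N`. -/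
lemma totalCost_mem (G : CostSharingGame N A H) (σ : A → ℝ) (s : Fin N → A) :
    G.totalCost σ s ∈ Set.Icc 0 (Fintype.card A * H) := by
  rw [totalCost_eq_sum_agentCost]
  refine ⟨Finset.sum_nonneg fun i _ => div_nonneg (G.meanCost_mem _).1 (Nat.cast_nonneg _), ?_⟩
  rw [← Finset.sum_fiberwise Finset.univ s fun i => G.agentCost s i, ← nsmul_eq_mul,
    ← Finset.card_univ]
  refine Finset.sum_le_card_nsmul _ _ _ fun a _ => ?_
  have h1 : ∑ i with s i = a, G.agentCost s i = ∑ i with s i = a, G.meanCost a / users s a :=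
    Finset.sum_congr rfl fun i hi => by rw [agentCost, (Finset.mem_filter.1 hi).2]
  rw [h1, Finset.sum_const, nsmul_eq_mul]
  have h2 := G.meanCost_mem a
  change (users s a : ℝ) * _ ≤ H
  rcases Nat.eq_zero_or_pos (users s a) with h0 | h0
  · rw [h0]; simpa using h2.1.trans h2.2
  · rw [mul_div_cancel₀ _ (by positivity)]; exact h2.2

lemma loss_mem (G : CostSharingGame N A H) (σ : A → ℝ) :
    G.loss σ ∈ Set.Icc 0 (Fintype.card A * H) := by
  obtain ⟨s, -, hs⟩ := (G.isGreatest_loss σ).1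
  exact hs ▸ G.totalCost_mem σ s

/-- The losses on finitely many games take few values as the subsidies vary. -/
lemma card_le_of_injOn_loss {κ T : Type*} [Fintype κ] (G : κ → CostSharingGame N A H)
    (σ : T → A → ℝ) (s : Finset T) (hs : Set.InjOn (fun t k => (G k).loss (σ t)) (s : Set T)) :
    s.card ≤ (Fintype.card A ^ 2 * N ^ 2 * Fintype.card κ + 1) ^ (Fintype.card A + 1) := by
  classical
  -- The index `(k, (a, b), (i, j))` stands for the comparison, in game `k`, of the share of `a`
  -- among `i + 1` users with that of `b` among `j + 1` users.
  have h := card_le_of_injOn_nonneg_pattern (P := κ × (A × A) × (Fin N × Fin N))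
    (fun p a => (if a = p.2.1.1 then 1 / ((p.2.2.1 : ℝ) + 1) else 0) -
      if a = p.2.1.2 then 1 / ((p.2.2.2 : ℝ) + 1) else 0)
    (fun p => (G p.1).meanCost p.2.1.2 / ((p.2.2.2 : ℝ) + 1) -
      (G p.1).meanCost p.2.1.1 / ((p.2.2.1 : ℝ) + 1)) σ s ?_
  · convert h using 3
    simp only [Fintype.card_prod, Fintype.card_fin]
    ring
  · intro t ht t' ht' he
    refine hs ht ht' (funext fun k => (G k).loss_congr fun a b i j => ?_)
    have h1 := Finset.ext_iff.1 he (k, (a, b), (i, j))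
    simp only [Finset.mem_filter_univ, sub_mul, ite_mul, zero_mul, Finset.sum_sub_distrib,
      Finset.sum_ite_eq', Finset.mem_univ, if_true] at h1
    have h2 : ∀ τ : A → ℝ, 1 / ((i : ℝ) + 1) * τ a - 1 / ((j : ℝ) + 1) * τ b +
        ((G k).meanCost b / ((j : ℝ) + 1) - (G k).meanCost a / ((i : ℝ) + 1)) =
        ((G k).meanCost b - τ b) / (j + 1) - ((G k).meanCost a - τ a) / (i + 1) := by
      intro τ
      ring
    simpa only [h2, sub_nonneg] using h1

/-- The loss need not be continuous in `σ`, so compactness is not used. The empirical loss takes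
finitely many values, because on each game it is the cost of one of finitely many joint actions. -/
lemma exists_isBestOnSample (hH : 0 ≤ H) {m : ℕ} (S : Fin m → CostSharingGame N A H) :
    ∃ σ, IsBestOnSample S σ := by
  have hfin : (empiricalLoss S '' subsidyVectors A H).Finite := by
    refine (Set.finite_range fun s : Fin m → Fin N → A =>
      (∑ k, ∑ i, (S k).agentCost (s k) i) / (m : ℝ)).subset ?_
    rintro _ ⟨σ, -, rfl⟩
    choose s _ hs using fun k => ((S k).isGreatest_loss σ).1
    refine ⟨s, ?_⟩
    simp only [empiricalLoss, hs, totalCost_eq_sum_agentCost]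
  obtain ⟨_, ⟨σ, hσ, rfl⟩, hmin⟩ := Set.exists_min_image _ id hfin
    ⟨_, 0, fun _ => ⟨le_rfl, hH⟩, rfl⟩
  exact ⟨σ, hσ, fun τ hτ => hmin _ ⟨τ, hτ, rfl⟩⟩

end CostSharingGame

/-! ### Measurable projections in `σ`-compact spaces. -/

section DeltaTwo

variable {Y Z : Type*} [TopologicalSpace Y] [TopologicalSpace Z]

/-- Sets that are both `Gδ` and `Fσ`. -/
def IsDeltaTwo (s : Set Y) : Prop :=
  IsGδ s ∧ IsGδ sᶜ

lemma IsClosed.isDeltaTwo [PerfectlyNormalSpace Y] {s : Set Y} (hs : IsClosed s) :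
    IsDeltaTwo s :=
  ⟨hs.isGδ, hs.isOpen_compl.isGδ⟩

lemma IsOpen.isDeltaTwo [PerfectlyNormalSpace Y] {s : Set Y} (hs : IsOpen s) : IsDeltaTwo s :=
  ⟨hs.isGδ, hs.isClosed_compl.isGδ⟩

lemma IsDeltaTwo.compl {s : Set Y} (hs : IsDeltaTwo s) : IsDeltaTwo sᶜ :=
  ⟨hs.2, by rw [compl_compl]; exact hs.1⟩

lemma IsDeltaTwo.inter {s t : Set Y} (hs : IsDeltaTwo s) (ht : IsDeltaTwo t) :
    IsDeltaTwo (s ∩ t) :=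
  ⟨hs.1.inter ht.1, by rw [Set.compl_inter]; exact hs.2.union ht.2⟩

lemma isDeltaTwo_const [PerfectlyNormalSpace Y] (p : Prop) : IsDeltaTwo {_y : Y | p} :=
  isClosed_const.isDeltaTwo

lemma IsDeltaTwo.setOf_and {p q : Y → Prop} (hp : IsDeltaTwo {y | p y})
    (hq : IsDeltaTwo {y | q y}) : IsDeltaTwo {y | p y ∧ q y} :=
  hp.inter hq

lemma IsDeltaTwo.setOf_imp {p q : Y → Prop} (hp : IsDeltaTwo {y | p y})
    (hq : IsDeltaTwo {y | q y}) : IsDeltaTwo {y | p y → q y} := by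
  have : {y | p y → q y} = ({y | p y} ∩ {y | q y}ᶜ)ᶜ := by ext; simp
  rw [this]
  exact (hp.inter hq.compl).compl

lemma IsDeltaTwo.setOf_forall {κ : Type*} [Finite κ] {p : κ → Y → Prop}
    (h : ∀ k, IsDeltaTwo {y | p k y}) : IsDeltaTwo {y | ∀ k, p k y} := by
  have : {y | ∀ k, p k y} = ⋂ k, {y | p k y} := by ext; simp
  rw [this]
  exact ⟨IsGδ.iInter fun k => (h k).1, by rw [Set.compl_iInter]; exact IsGδ.iUnion fun k => (h k).2⟩

lemma IsDeltaTwo.setOf_exists {κ : Type*} [Finite κ] {p : κ → Y → Prop}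
    (h : ∀ k, IsDeltaTwo {y | p k y}) : IsDeltaTwo {y | ∃ k, p k y} := by
  have : {y | ∃ k, p k y} = {y | ∀ k, ¬p k y}ᶜ := by ext; simp
  rw [this]
  exact (IsDeltaTwo.setOf_forall fun k => (h k).compl).compl

/-- The `Fσ` half suffices here; the `Gδ` half serves to make the class stable under complements. -/
lemma IsDeltaTwo.isSigmaCompact [SigmaCompactSpace Y] {s : Set Y} (hs : IsDeltaTwo s) :
    IsSigmaCompact s := by
  obtain ⟨U, hU, hs'⟩ := isGδ_iff_eq_iInter_nat.1 hs.2
  have : s = ⋃ n, (U n)ᶜ := by rw [← Set.compl_iInter, ← hs', compl_compl]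
  rw [this]
  exact isSigmaCompact_iUnion _ fun n =>
    isSigmaCompact_univ.of_isClosed_subset (hU n).isClosed_compl (Set.subset_univ _)

lemma IsSigmaCompact.measurableSet [T2Space Y] [MeasurableSpace Y] [OpensMeasurableSpace Y]
    {s : Set Y} (hs : IsSigmaCompact s) : MeasurableSet s := by
  obtain ⟨K, hK, rfl⟩ := hs
  exact MeasurableSet.iUnion fun n => (hK n).measurableSet

/-- Projections of sets that are `Gδ` and `Fσ` in a `σ`-compact space are measurable. -/
lemma IsDeltaTwo.measurableSet_setOf_exists [SigmaCompactSpace Y] [SigmaCompactSpace Z]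
    [T2Space Z] [MeasurableSpace Z] [OpensMeasurableSpace Z] {p : Y → Z → Prop}
    (h : IsDeltaTwo {x : Y × Z | p x.1 x.2}) : MeasurableSet {z | ∃ y, p y z} := by
  have : {z | ∃ y, p y z} = Prod.snd '' {x : Y × Z | p x.1 x.2} := by ext; simp
  rw [this]
  exact (h.isSigmaCompact.image continuous_snd).measurableSet

end DeltaTwo

/-! ### Measurability of the symmetrized event. -/

namespace CostSharingGame

variable {N : ℕ} {A : Type*} {H : ℝ} [DecidableEq A]

/-- The subsidized cost of agent `i` when the vector of mean costs is `w`. -/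
noncomputable def costShare (w σ : A → ℝ) (s : Fin N → A) (i : Fin N) : ℝ :=
  w (s i) / users s (s i) - σ (s i) / users s (s i)

/-- The total cost of `s` when the vector of mean costs is `w`. -/
noncomputable def socialCost (w : A → ℝ) (s : Fin N → A) : ℝ :=
  ∑ i, w (s i) / users s (s i)

/-- The joint action `s` is a Nash equilibrium for the availability map `f` and mean costs `w`. -/
def IsEquilibrium (f : A → Finset (Fin N)) (w σ : A → ℝ) (s : Fin N → A) : Prop :=
  (∀ i, i ∈ f (s i)) ∧ ∀ i a, i ∈ f a →
    costShare w σ s i ≤ costShare w σ (Function.update s i a) i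

/-- A Nash equilibrium of largest total cost. -/
def IsWorstEquilibrium (f : A → Finset (Fin N)) (w σ : A → ℝ) (s : Fin N → A) : Prop :=
  IsEquilibrium f w σ s ∧ ∀ s', IsEquilibrium f w σ s' → socialCost w s' ≤ socialCost w s

/-- Replaces the supremum by an existential over finitely many joint actions, with conditions on `σ`
and the mean costs alone once the availability map is fixed. -/
lemma loss_eq_iff [Fintype A] (G : CostSharingGame N A H) (σ : A → ℝ) (x : ℝ) :
    G.loss σ = x ↔
      ∃ s, IsWorstEquilibrium G.avail G.meanCost σ s ∧ socialCost G.meanCost s = x := by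
  have hG := G.isGreatest_loss σ
  simp only [totalCost_eq_sum_agentCost] at hG
  constructor
  · rintro rfl
    obtain ⟨s, hs, he⟩ := hG.1
    exact ⟨s, ⟨hs, fun s' hs' => (hG.2 ⟨s', hs', rfl⟩).trans_eq he⟩, he.symm⟩
  · rintro ⟨s, hs, rfl⟩
    refine hG.unique ⟨⟨s, hs.1, rfl⟩, ?_⟩
    rintro _ ⟨s', hs', rfl⟩
    exact hs.2 s' hs'

variable {W : Type*} [TopologicalSpace W]

lemma continuous_socialCost {w : W → A → ℝ} (hw : Continuous w) (s : Fin N → A) :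
    Continuous fun y => socialCost (w y) s := by
  unfold socialCost
  fun_prop

lemma isDeltaTwo_setOf_isEquilibrium [PerfectlyNormalSpace W] [Finite A]
    (f : A → Finset (Fin N)) {w σ : W → A → ℝ} (hw : Continuous w) (hσ : Continuous σ)
    (s : Fin N → A) :
    IsDeltaTwo {y | IsEquilibrium f (w y) (σ y) s} := by
  have hc : ∀ s : Fin N → A, ∀ i, Continuous fun y => costShare (w y) (σ y) s i := by
    intro s i
    unfold costShare
    fun_prop
  exact (isDeltaTwo_const _).inter <| .setOf_forall fun i => .setOf_forall fun a =>
    .setOf_imp (isDeltaTwo_const _) (isClosed_le (hc _ _) (hc _ _)).isDeltaTwo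

/-- Being worst is an implication with a closed premise, hence in general neither open nor closed.
-/
lemma isDeltaTwo_setOf_isWorstEquilibrium [PerfectlyNormalSpace W] [Finite A]
    (f : A → Finset (Fin N)) {w σ : W → A → ℝ} (hw : Continuous w) (hσ : Continuous σ)
    (s : Fin N → A) :
    IsDeltaTwo {y | IsWorstEquilibrium f (w y) (σ y) s} :=
  (isDeltaTwo_setOf_isEquilibrium f hw hσ s).inter <| .setOf_forall fun s' =>
    (isDeltaTwo_setOf_isEquilibrium f hw hσ s').setOf_imp
      (isClosed_le (continuous_socialCost hw _) (continuous_socialCost hw _)).isDeltaTwo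

/-- Games enter only through availability, which has finitely many values, and mean costs, which are
measurable with values in a Euclidean space. For each availability pattern the event is the preimage
of a projection along `σ`. -/
lemma measurableSet_setOf_exists_lt_abs_sum_loss_sub [Fintype A] {ι : Type*} [Fintype ι] (c : ℝ) :
    MeasurableSet {z : ι → CostSharingGame N A H × CostSharingGame N A H |
      ∃ σ : subsidyVectors A H, c < |∑ k, ((z k).1.loss σ - (z k).2.loss σ)|} := by
  set w : (ι → CostSharingGame N A H × CostSharingGame N A H) → ι → (A → ℝ) × (A → ℝ) :=
    fun z k => ((z k).1.meanCost, (z k).2.meanCost) with hw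
  have hwm : Measurable w := by
    refine measurable_pi_iff.2 fun k => Measurable.prodMk ?_ ?_
    · exact measurable_pi_iff.2 fun a =>
        (measurable_meanCost a).comp (measurable_fst.comp (measurable_pi_apply k))
    · exact measurable_pi_iff.2 fun a =>
        (measurable_meanCost a).comp (measurable_snd.comp (measurable_pi_apply k))
  set R : (ι → (A → Finset (Fin N)) × (A → Finset (Fin N))) → (A → ℝ) →
      (ι → (A → ℝ) × (A → ℝ)) → Prop := fun f σ w =>
    σ ∈ subsidyVectors A H ∧ ∃ s : ι → (Fin N → A) × (Fin N → A),
      (∀ k, IsWorstEquilibrium (f k).1 (w k).1 σ (s k).1) ∧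
      (∀ k, IsWorstEquilibrium (f k).2 (w k).2 σ (s k).2) ∧
      c < |∑ k, (socialCost (w k).1 (s k).1 - socialCost (w k).2 (s k).2)| with hR
  have hRm : ∀ f, MeasurableSet {w | ∃ σ, R f σ w} := by
    intro f
    refine IsDeltaTwo.measurableSet_setOf_exists (.setOf_and ?_ (.setOf_exists fun s => ?_))
    · refine .setOf_forall fun a => IsClosed.isDeltaTwo ?_
      exact isClosed_Icc.preimage (by fun_prop)
    · refine .setOf_and (.setOf_forall fun k => ?_) (.setOf_and (.setOf_forall fun k => ?_) ?_)
      · exact isDeltaTwo_setOf_isWorstEquilibrium _ (by fun_prop) (by fun_prop) _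
      · exact isDeltaTwo_setOf_isWorstEquilibrium _ (by fun_prop) (by fun_prop) _
      · refine IsOpen.isDeltaTwo (isOpen_lt continuous_const (continuous_abs.comp ?_))
        exact continuous_finsetSum _ fun k _ =>
          (continuous_socialCost (by fun_prop) _).sub (continuous_socialCost (by fun_prop) _)
  have hset : {z : ι → CostSharingGame N A H × CostSharingGame N A H |
      ∃ σ : subsidyVectors A H, c < |∑ k, ((z k).1.loss σ - (z k).2.loss σ)|} =
      ⋃ f : ι → (A → Finset (Fin N)) × (A → Finset (Fin N)),
        (⋂ k, ({z | (z k).1.avail = (f k).1} ∩ {z | (z k).2.avail = (f k).2})) ∩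
          w ⁻¹' {w | ∃ σ, R f σ w} := by
    ext z
    simp only [Set.mem_ofPred_eq, Set.mem_iUnion, Set.mem_inter_iff, Set.mem_iInter,
      Set.mem_preimage]
    constructor
    · rintro ⟨⟨σ, hσ⟩, hz⟩
      choose s₁ h₁ e₁ using fun k => ((z k).1.loss_eq_iff σ _).1 rfl
      choose s₂ h₂ e₂ using fun k => ((z k).2.loss_eq_iff σ _).1 rfl
      refine ⟨fun k => ((z k).1.avail, (z k).2.avail), fun k => ⟨rfl, rfl⟩, σ, hσ,
        fun k => (s₁ k, s₂ k), h₁, h₂, ?_⟩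
      simpa only [hw, e₁, e₂] using hz
    · rintro ⟨f, hf, σ, hσ, s, h₁, h₂, hlt⟩
      refine ⟨⟨σ, hσ⟩, ?_⟩
      have e₁ : ∀ k, (z k).1.loss σ = socialCost (w z k).1 (s k).1 := fun k =>
        ((z k).1.loss_eq_iff σ _).2 ⟨_, (hf k).1 ▸ h₁ k, rfl⟩
      have e₂ : ∀ k, (z k).2.loss σ = socialCost (w z k).2 (s k).2 := fun k =>
        ((z k).2.loss_eq_iff σ _).2 ⟨_, (hf k).2 ▸ h₂ k, rfl⟩
      simpa only [e₁, e₂] using hlt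
  rw [hset]
  have hav : ∀ f, MeasurableSet {G : CostSharingGame N A H | G.avail = f} :=
    fun f => measurable_avail (t := {f}) trivial
  refine MeasurableSet.iUnion fun f => .inter (.iInter fun k => .inter ?_ ?_) (hwm (hRm f))
  · exact (measurable_fst.comp (measurable_pi_apply k)) (hav _)
  · exact (measurable_snd.comp (measurable_pi_apply k)) (hav _)

end CostSharingGame

/-! ### Constants and conclusion. -/

namespace CostSharingGame

variable {N : ℕ} {A : Type*} {H : ℝ} [DecidableEq A]

/-- Serves the degenerate cases of no agents or at most one action. -/
lemma loss_eq_of_subsingleton [Fintype A] [Subsingleton (Fin N → A)] (G : CostSharingGame N A H)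
    (σ τ : A → ℝ) : G.loss σ = G.loss τ := by
  obtain ⟨s, -, hs⟩ := (G.isGreatest_loss σ).1
  obtain ⟨t, -, ht⟩ := (G.isGreatest_loss τ).1
  rw [hs, ht, totalCost_eq_sum_agentCost, totalCost_eq_sum_agentCost, Subsingleton.elim s t]

/-- Empirical minimizers are nearly optimal on samples where all averages are close to the
expectations. -/
lemma IsBestOnSample.expectedLoss_le {D : Measure (CostSharingGame N A H)} {m : ℕ} {ε : ℝ}
    {S : Fin m → CostSharingGame N A H} {σ τ : A → ℝ} (hσ : IsBestOnSample S σ)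
    (hτ : τ ∈ subsidyVectors A H)
    (hS : ∀ υ ∈ subsidyVectors A H, |empiricalLoss S υ - expectedLoss D υ| ≤ ε / 2) :
    expectedLoss D σ ≤ expectedLoss D τ + ε := by
  have h1 := abs_le.1 (hS σ hσ.1)
  have h2 := abs_le.1 (hS τ hτ)
  linarith [hσ.2 τ hτ]

/-- Uniform convergence of the empirical losses. -/
lemma exists_measurableSet_forall_abs_empiricalLoss_sub_le [Fintype A] (hN : 1 ≤ N)
    (hA : 2 ≤ Fintype.card A) (hH : 0 < H) {ε δ : ℝ} (hε : 0 < ε) (hδ : 0 < δ) (hδ1 : δ < 1)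
    (D : Measure (CostSharingGame N A H)) [IsProbabilityMeasure D] {m : ℕ}
    (hm : 1000000 * ((Fintype.card A : ℝ) ^ 2 * H ^ 2 / ε ^ 2 *
      (Fintype.card A * Real.log (Fintype.card A * N) + Real.log (1 / δ))) ≤ m) :
    ∃ E : Set (Fin m → CostSharingGame N A H), MeasurableSet E ∧
      ENNReal.ofReal (1 - δ) ≤ Measure.pi (fun _ : Fin m => D) E ∧
      ∀ S ∈ E, ∀ σ ∈ subsidyVectors A H,
        |empiricalLoss S σ - expectedLoss D σ| ≤ ε / 2 := by
  set n := Fintype.card A with hn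
  have hA' : (2 : ℝ) ≤ n := by exact_mod_cast hA
  have hN' : (1 : ℝ) ≤ N := by exact_mod_cast hN
  set u : ℝ := n * N with hu
  have hu2 : 2 ≤ u := by nlinarith
  have hlog2 : 0 < Real.log 2 := Real.log_pos (by norm_num)
  have hlogu : Real.log 2 ≤ Real.log u := Real.log_le_log (by norm_num) hu2
  have hlogu0 : 0 < Real.log u := hlog2.trans_le hlogu
  have hlog4 : Real.log 4 = 2 * Real.log 2 := by
    rw [show (4 : ℝ) = 2 ^ 2 by norm_num, Real.log_pow]; norm_num
  have hlog16 : Real.log (16 / δ) = 4 * Real.log 2 + Real.log (1 / δ) := by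
    rw [show (16 : ℝ) / δ = 2 ^ 4 * (1 / δ) by ring,
      Real.log_mul (by positivity) (by positivity), Real.log_pow]
    norm_num
  have hlogδ : 0 < Real.log (1 / δ) := Real.log_pos ((one_lt_div hδ).2 hδ1)
  have hV : 2 * Real.log u ≤ n * Real.log u := by gcongr
  set B := n * H with hB
  have hB0 : 0 < B := by positivity
  have hm' : 1000000 * B ^ 2 * (n * Real.log u + Real.log (1 / δ)) ≤ m * ε ^ 2 := by
    have h1 := mul_le_mul_of_nonneg_right hm (sq_nonneg ε)
    refine le_trans (le_of_eq ?_) h1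
    rw [hB]
    field_simp
  have hm0 : 0 < m := by
    rw [Nat.pos_iff_ne_zero]
    rintro rfl
    have h1 : 0 < 1000000 * B ^ 2 * (n * Real.log u + Real.log (1 / δ)) := by
      have : 0 < n * Real.log u := by linarith
      positivity
    simp only [Nat.cast_zero, zero_mul] at hm'
    linarith
  have : Nonempty (Fin m) := ⟨⟨0, hm0⟩⟩
  have hd : ((n + 1 : ℕ) : ℝ) ≤ 2 * n := by push_cast; linarith
  have hlogK : Real.log (16 * (n ^ 2 * N ^ 2 : ℕ) * (n + 1 : ℕ)) ≤ 8 * Real.log u := by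
    have h1 : (16 * (n ^ 2 * N ^ 2 : ℕ) * (n + 1 : ℕ) : ℝ) ≤ u ^ 8 := by
      have h2 : (n : ℝ) ≤ u := le_mul_of_one_le_right (by positivity) hN'
      have h3 : ((n ^ 2 * N ^ 2 : ℕ) : ℝ) = u ^ 2 := by rw [hu]; push_cast; ring
      rw [h3]
      calc 16 * u ^ 2 * (n + 1 : ℕ) ≤ 16 * u ^ 2 * (2 * u) := by gcongr; linarith
        _ = 2 ^ 5 * u ^ 3 := by ring
        _ ≤ u ^ 5 * u ^ 3 := by gcongr
        _ = u ^ 8 := by ring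
    have h2 : (0 : ℝ) < (n ^ 2 * N ^ 2 : ℕ) := by positivity
    refine (Real.log_le_log (by positivity) h1).trans_eq ?_
    rw [Real.log_pow]
    norm_num
  have hM1 : 2 * ((n + 1 : ℕ) : ℝ) * Real.log (16 * (n ^ 2 * N ^ 2 : ℕ) * (n + 1 : ℕ)) ≤
      32 * (n * Real.log u) := by
    calc _ ≤ 2 * ((n + 1 : ℕ) : ℝ) * (8 * Real.log u) := by gcongr
      _ ≤ 2 * (2 * n) * (8 * Real.log u) := by gcongr
      _ = _ := by ring
  have hM2 : 2 * ((n + 1 : ℕ) : ℝ) * Real.log 4 ≤ 32 * (n * Real.log u) := by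
    rw [hlog4]
    calc _ ≤ 2 * (2 * n) * (2 * Real.log u) := by gcongr
      _ ≤ _ := by linarith
  -- Since `4 log 2 ≤ 2 n log u`, the coefficient of `n log u` is at most `5184 * (96 + 2) =
  -- 508032`, below `1000000`.
  have hmε : 5184 * B ^ 2 * (3 * (32 * (n * Real.log u)) + Real.log (16 / δ)) ≤
      Fintype.card (Fin m) * ε ^ 2 := by
    rw [Fintype.card_fin, hlog16]
    refine le_trans ?_ hm'
    have h1 : 0 ≤ B ^ 2 := by positivity
    nlinarith
  obtain ⟨E, hE, hprob, hdev⟩ := exists_measurableSet_forall_abs_average_sub_integral_le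
    (ι := Fin m) (T := subsidyVectors A H) D (fun σ G => G.loss σ) hB0
    (fun σ => measurable_loss σ.1) (fun σ G => G.loss_mem σ) (K := n ^ 2 * N ^ 2) (d := n + 1)
    (Nat.one_le_iff_ne_zero.2 (by positivity)) (by omega)
    (fun κ _ x s hs => card_le_of_injOn_loss x _ s hs)
    measurableSet_setOf_exists_lt_abs_sum_loss_sub hM1 hM2 hε hδ hδ1.le hmε
  refine ⟨E, hE, hprob, fun S hS σ hσ => ?_⟩
  have := hdev S hS ⟨σ, hσ⟩
  rwa [Fintype.card_fin] at this

end CostSharingGame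

theorem mainTheorem8 :
    ∃ C : ℝ, 0 < C ∧
      ∀ (N : ℕ) (A : Type*) [Fintype A] [DecidableEq A] (H ε δ : ℝ), 0 ≤ H → 0 < ε → 0 < δ →
      ∀ (D : Measure (CostSharingGame N A H)) [IsProbabilityMeasure D]
        (m : ℕ),
        C * ((Fintype.card A : ℝ) ^ 2 * H ^ 2 / ε ^ 2 *
          (Fintype.card A * Real.log (Fintype.card A * N) + Real.log (1 / δ))) ≤ m →
        -- a best vector over the sample always exists
        (∀ S : Fin m → CostSharingGame N A H, ∃ σ, CostSharingGame.IsBestOnSample S σ) ∧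
        -- and with probability at least `1 - δ` every such vector is nearly optimal
        ∃ E : Set (Fin m → CostSharingGame N A H), MeasurableSet E ∧
          ENNReal.ofReal (1 - δ) ≤ Measure.pi (fun _ : Fin m => D) E ∧
          ∀ S ∈ E, ∀ σ, CostSharingGame.IsBestOnSample S σ → ∀ τ ∈ CostSharingGame.subsidyVectors A H,
            CostSharingGame.expectedLoss D σ ≤ CostSharingGame.expectedLoss D τ + ε := by
  refine ⟨1000000, by norm_num, ?_⟩
  intro N A _ _ H ε δ hH hε hδ D _ m hm
  refine ⟨CostSharingGame.exists_isBestOnSample hH, ?_⟩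
  rcases le_or_gt 1 δ with hδ1 | hδ1
  · exact ⟨∅, MeasurableSet.empty, by simp [ENNReal.ofReal_of_nonpos (sub_nonpos.2 hδ1)], by simp⟩
  -- When the loss does not depend on the admissible subsidy, every sample is good, even with `m =
  -- 0`. Excluding these cases leaves `#A * N ≥ 2`, so the logarithm is positive.
  have hconst (h : ∀ σ ∈ CostSharingGame.subsidyVectors A H,
      ∀ τ ∈ CostSharingGame.subsidyVectors A H, ∀ G : CostSharingGame N A H,
        G.loss σ = G.loss τ) :
      ∃ E : Set (Fin m → CostSharingGame N A H), MeasurableSet E ∧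
        ENNReal.ofReal (1 - δ) ≤ Measure.pi (fun _ : Fin m => D) E ∧
        ∀ S ∈ E, ∀ σ, CostSharingGame.IsBestOnSample S σ →
          ∀ τ ∈ CostSharingGame.subsidyVectors A H,
          CostSharingGame.expectedLoss D σ ≤ CostSharingGame.expectedLoss D τ + ε := by
    refine ⟨Set.univ, MeasurableSet.univ, ?_, fun S _ σ hσ τ hτ => ?_⟩
    · rw [measure_univ, ← ENNReal.ofReal_one]
      exact ENNReal.ofReal_le_ofReal (by linarith)
    · simp only [CostSharingGame.expectedLoss, h σ hσ.1 τ hτ]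
      linarith
  rcases hH.eq_or_lt with rfl | hH
  · refine hconst fun σ hσ τ hτ G => ?_
    have : σ = τ := funext fun a =>
      le_antisymm ((hσ a).2.trans (hτ a).1) ((hτ a).2.trans (hσ a).1)
    rw [this]
  rcases Nat.eq_zero_or_pos N with rfl | hN
  · exact hconst fun σ _ τ _ G => G.loss_eq_of_subsingleton σ τ
  rcases Nat.lt_or_ge (Fintype.card A) 2 with hA | hA
  · have : Subsingleton A := Fintype.card_le_one_iff_subsingleton.1 (by omega)
    exact hconst fun σ _ τ _ G => G.loss_eq_of_subsingleton σ τ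
  obtain ⟨E, hE, hprob, hdev⟩ :=
    CostSharingGame.exists_measurableSet_forall_abs_empiricalLoss_sub_le hN hA hH hε hδ hδ1 D hm
  exact ⟨E, hE, hprob, fun S hS σ hσ τ hτ => hσ.expectedLoss_le hτ (hdev S hS)⟩
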